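/- **Theorem 4.2 (Deterministic Aizenman's Theorem).** Let $U$ be a unitary operator on a complex Hilbert space $\mathcal H$ and let $\varphi\in\mathcal H$ be a unit vector that is cyclic for $U$, i.e. the linear span of $\{U^k\varphi : k\in\mathbb Z\}$ is dense in $\mathcal H$. Let $\mu$ be the spectral measure of $U$ and $\varphi$ on the unit circle $\partial\mathbb D$, i.e. $\langle\varphi,f(U)\varphi\rangle=\int f\,d\mu$ for all continuous $f$ on $\partial\mathbb D$, and suppose that $$G(z_0)=\int\frac{d\mu(\theta)}{|z_0-e^{i\theta}|^2}<\infty\qquad\text{for Lebesgue-a.e. } z_0\in\partial\mathbb D .$$ Let $P=\langle\varphi,\cdot\,\rangle\varphi$ and, for $|\lambda|=1$, let $U_\lambda=U[(1-P)+\lambda P]$, which is again unitary. Let $\psi\in\mathcal H$ with $\psi\perp\varphi$ and $\|\psi\|\le 1$. Then for every $0<p<1$: the limit $\lim_{r\uparrow1}\langle\varphi,(U+re^{i\theta})(U-re^{i\theta})^{-1}\psi\rangle$ exists in $\mathbb C$ for a.e. $\theta$; the functions $\theta\mapsto\lim_{r\uparrow1}|\langle\varphi,(U+re^{i\theta})(U-re^{i\theta})^{-1}\psi\rangle|^p$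 and $\eta\mapsto\sup_{n\in\mathbb Z}|\langle\varphi,U_{e^{i\eta}}^n\psi\rangle|$ are integrable over $[0,2\pi]$, the supremum being finite for every $\eta$; and $$\int_0^{2\pi}\sup_{n\in\mathbb Z}\bigl|\langle\varphi,U_{e^{i\eta}}^n\psi\rangle\bigr|\,\frac{d\eta}{2\pi}\le\biggl(\int_0^{2\pi}\lim_{r\uparrow1}\bigl|\langle\varphi,(U+re^{i\theta})(U-re^{i\theta})^{-1}\psi\rangle\bigr|^p\,\frac{d\theta}{2\pi}\biggr)^{1/(2-p)} .$$ -/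

import Mathlib

open MeasureTheory Filter Topology
open scoped ENNReal InnerProductSpace CompactlySupported

noncomputable section

namespace RankOneUnitary

variable {H : Type*} [NormedAddCommGroup H] [InnerProductSpace ℂ H] [CompleteSpace H]

/-- `φ` is cyclic for the unitary `U`: the vectors `U ^ k φ`, `k ∈ ℤ`, span a dense subspace. -/
def IsCyclic (U : unitary (H →L[ℂ] H)) (φ : H) : Prop :=
  (Submodule.span ℂ (Set.range fun k : ℤ =>
    ((U ^ k : unitary (H →L[ℂ] H)) : H →L[ℂ] H) φ)).topologicalClosure = ⊤

/-- The orthogonal projection `P = ⟨φ, ·⟩ φ` onto the multiples of a unit vector `φ`. -/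
def proj (φ : H) : H →L[ℂ] H := InnerProductSpace.rankOne ℂ φ φ

lemma proj_apply (φ x : H) : proj φ x = ⟪φ, x⟫_ℂ • φ := by
  simp [proj]

lemma star_proj (φ : H) : star (proj φ) = proj φ := by
  rw [ContinuousLinearMap.star_eq_adjoint, eq_comm, ContinuousLinearMap.eq_adjoint_iff]
  intro x y
  simp only [proj_apply, inner_smul_left, inner_smul_right, inner_conj_symm]
  ring

lemma proj_mul_proj {φ : H} (hφ : ‖φ‖ = 1) : proj φ * proj φ = proj φ := by
  ext x
  simp [proj_apply, inner_self_eq_norm_sq_to_K, hφ]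

lemma one_sub_proj_add_mem_unitary {φ : H} (hφ : ‖φ‖ = 1) (l : Circle) :
    (1 - proj φ) + (l : ℂ) • proj φ ∈ unitary (H →L[ℂ] H) := by
  have h1 : (starRingEnd ℂ) (l : ℂ) * l = 1 := by
    rw [← Complex.normSq_eq_conj_mul_self]; simp
  have h2 : (l : ℂ) * (starRingEnd ℂ) (l : ℂ) = 1 := by rw [mul_comm, h1]
  have hq : proj φ * (1 - proj φ) = 0 := by rw [mul_sub, proj_mul_proj hφ, mul_one, sub_self]
  have hq' : (1 - proj φ) * proj φ = 0 := by rw [sub_mul, proj_mul_proj hφ, one_mul, sub_self]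
  have hqq : (1 - proj φ) * (1 - proj φ) = 1 - proj φ := by
    rw [mul_sub, hq', mul_one, sub_zero]
  have hs : star ((1 - proj φ) + (l : ℂ) • proj φ) =
      (1 - proj φ) + (starRingEnd ℂ) (l : ℂ) • proj φ := by
    rw [star_add, star_sub, star_one, star_smul, star_proj]; rfl
  have key : ∀ a b : ℂ, a * b = 1 →
      ((1 - proj φ) + a • proj φ) * ((1 - proj φ) + b • proj φ) = 1 := by
    intro a b hab
    rw [add_mul, mul_add, mul_add, hqq, mul_smul_comm, hq', smul_mul_assoc, hq,
      smul_mul_smul_comm, hab, proj_mul_proj hφ]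
    simp
  rw [Unitary.mem_iff, hs]
  exact ⟨key _ _ h1, key _ _ h2⟩

/-- The multiplicative rank one perturbation `U_λ = U [(1 - P) + λ P]`, `|λ| = 1`,
as a unitary operator. -/
def perturb (U : unitary (H →L[ℂ] H)) (φ : H) (hφ : ‖φ‖ = 1) (l : Circle) :
    unitary (H →L[ℂ] H) :=
  U * ⟨(1 - proj φ) + (l : ℂ) • proj φ, one_sub_proj_add_mem_unitary hφ l⟩

/-- The matrix element `⟨φ, (U + z) (U - z)⁻¹ ψ⟩`; it is only used for `|z| < 1`, where
`U - z` is invertible. -/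
def carath (U : unitary (H →L[ℂ] H)) (φ ψ : H) (z : ℂ) : ℂ :=
  ⟪φ, (((U : H →L[ℂ] H) + z • 1) * Ring.inverse ((U : H →L[ℂ] H) - z • 1)) ψ⟫_ℂ

/-- The inclusion of the spectrum of a unitary into the unit circle. -/
def spectrumToCircle (U : unitary (H →L[ℂ] H)) :
    C(spectrum ℂ (U : H →L[ℂ] H), Circle) where
  toFun z := ⟨z, by
    have h := Unitary.spectrum_subset_circle (𝕜 := ℂ) U z.2
    simpa [Submonoid.unitSphere] using h⟩
  continuous_toFun := by fun_prop

/-- `f(U)`, in the continuous functional calculus, for a real continuous `f` on the circle. -/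
def funCalc (U : unitary (H →L[ℂ] H)) (f : C_c(Circle, ℝ)) : H →L[ℂ] H :=
  cfcHom (R := ℂ) (a := (U : H →L[ℂ] H)) (Unitary.coe_isStarNormal U)
    ((⟨fun x => ((f x : ℝ) : ℂ), by fun_prop⟩ : C(Circle, ℂ)).comp (spectrumToCircle U))

/-- The positive linear functional `f ↦ ⟨φ, f(U) φ⟩` on continuous functions on the circle. -/
def spectralFunctional (U : unitary (H →L[ℂ] H)) (φ : H) : C_c(Circle, ℝ) →ₚ[ℝ] ℝ :=
  PositiveLinearMap.mk₀
    { toFun := fun f => (⟪φ, funCalc U f φ⟫_ℂ).re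
      map_add' := by
        intro f g
        have : funCalc U (f + g) = funCalc U f + funCalc U g := by
          unfold funCalc
          rw [← map_add]
          congr 1
          ext x
          simp
        simp [this]
      map_smul' := by
        intro c f
        have : funCalc U (c • f) = (c : ℂ) • funCalc U f := by
          unfold funCalc
          rw [← map_smul]
          congr 1
          ext x
          simp
        simp [this] }
    (by
      intro f hf
      have hf' : ∀ x, 0 ≤ f x := fun x => hf x
      let g : C(spectrum ℂ (U : H →L[ℂ] H), ℂ) :=
        (⟨fun x => ((Real.sqrt (f x) : ℝ) : ℂ), by fun_prop⟩ : C(Circle, ℂ)).comp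
          (spectrumToCircle U)
      have hg : funCalc U f = star (cfcHom (R := ℂ) (a := (U : H →L[ℂ] H)) (Unitary.coe_isStarNormal U) g) *
          cfcHom (R := ℂ) (a := (U : H →L[ℂ] H)) (Unitary.coe_isStarNormal U) g := by
        unfold funCalc
        rw [← map_star, ← map_mul]
        congr 1
        ext x
        simp [g, ← Complex.ofReal_mul, Real.mul_self_sqrt (hf' _)]
      change 0 ≤ (⟪φ, funCalc U f φ⟫_ℂ).re
      rw [hg, mul_apply_eq_comp, ContinuousLinearMap.star_eq_adjoint,
        ContinuousLinearMap.adjoint_inner_right]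
      exact inner_self_nonneg (𝕜 := ℂ))

/-- The unit circle carries its Borel `σ`-algebra. -/
instance : MeasurableSpace Circle := borel Circle

instance : BorelSpace Circle := ⟨rfl⟩

/-- The spectral measure `μ` of `U` and `φ` on the unit circle: the measure representing
`f ↦ ⟨φ, f(U) φ⟩`. -/
def spectralMeasure (U : unitary (H →L[ℂ] H)) (φ : H) : Measure Circle :=
  RealRMK.rieszMeasure (spectralFunctional U φ)

/-- `G(z₀) = ∫ dμ(w) / |z₀ - w|² ∈ [0, ∞]`, with `1 / 0 = ∞`. -/
def G (U : unitary (H →L[ℂ] H)) (φ : H) (z₀ : Circle) : ℝ≥0∞ :=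
  ∫⁻ w : Circle, (‖(z₀ : ℂ) - (w : ℂ)‖ₑ ^ 2)⁻¹ ∂(spectralMeasure U φ)

/-- The boundary value `lim_{r ↑ 1} |⟨φ, (U + r e^{iθ}) (U - r e^{iθ})⁻¹ ψ⟩| ^ p`. -/
def boundaryPow (U : unitary (H →L[ℂ] H)) (φ ψ : H) (p θ : ℝ) : ℝ :=
  limUnder (𝓝[<] (1 : ℝ)) fun r : ℝ => ‖carath U φ ψ ((r : ℂ) * (Circle.exp θ : ℂ))‖ ^ p

/-- `sup_n |⟨φ, U_λ ^ n ψ⟩|` over all `n ∈ ℤ`, for `λ = e^{iη}`. -/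
def supAmplitude (U : unitary (H →L[ℂ] H)) (φ ψ : H) (hφ : ‖φ‖ = 1) (η : ℝ) : ℝ :=
  ⨆ n : ℤ, ‖⟪φ, ((perturb U φ hφ (Circle.exp η) ^ n : unitary (H →L[ℂ] H)) :
    H →L[ℂ] H) ψ⟫_ℂ‖

end RankOneUnitary

end

noncomputable section

namespace RankOneUnitary

variable {H : Type*} [NormedAddCommGroup H] [InnerProductSpace ℂ H] [CompleteSpace H]

/-! Write μ_λ for the spectral measure of U_λ and φ, and ψ_λ ∈ L²(μ_λ) for the function representing
ψ (`spectralRep`). If G(z) < ∞, then w/(w - z) lies in L²(μ), and its image v_z in H (`poleVector`)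
solves (U - z)v = Uφ. Because ψ ⊥ φ, the radial limit of the matrix element at z is -2⟨v_z, ψ⟩
(`tendsto_carath`).

The same vector governs every perturbation: (U_λ - z)v_z is 1 - (1-λ)⟨φ, v_z⟩ times Uφ. Either this
factor is zero and v_z is an eigenvector of U_λ, or the potential ∫ |z - w|⁻² dμ_λ(w) is finite
(`G_lt_top_of_sub_eq_smul`). A finite measure gives no mass to the points where its own potential is
finite (`measure_setOf_lintegral_inv_sq_lt_top`). So if G < ∞ holds μ_λ-a.e., then μ_λ-a.e. point is
an atom with eigenvector v_z, and there ψ_λ(z) is conj(1-λ)⟨v_z, ψ⟩ (`ae_spectralRep_perturb`). With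
R the modulus of the radial limit, this says 2|ψ_λ| = |1-λ| R.

Spectral averaging (`bind_perturbKernel`) says that the average of μ_λ over λ is normalized Lebesgue
measure. It turns finiteness of G Lebesgue-a.e. into finiteness μ_λ-a.e. for a.e. λ. It also
finishes the estimate: the supremum over n is at most ∫|ψ_λ| dμ_λ; since ‖ψ_λ‖₂ ≤ 1, interpolation
between p and 2 bounds this by (∫|ψ_λ|^p dμ_λ)^(1/(2-p)); then |ψ_λ| ≤ R, and averaging with Jensen
for the exponent 1/(2-p) ≤ 1 gives the claim. Integrability of R^p follows from ∫ R^p dμ_λ ≤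
(2/|1-λ|)^p, which is integrable in λ because p < 1. -/

/-! ### Spectral representation on L² of the spectral measure -/

instance (U : unitary (H →L[ℂ] H)) (φ : H) : IsFiniteMeasure (spectralMeasure U φ) := by
  unfold spectralMeasure; infer_instance

instance (U : unitary (H →L[ℂ] H)) (φ : H) : (spectralMeasure U φ).Regular := by
  unfold spectralMeasure; infer_instance

/-- The continuous functional calculus `f ↦ f(U)` for complex continuous functions on the circle. -/
def circleCalc (U : unitary (H →L[ℂ] H)) : C(Circle, ℂ) →⋆ₐ[ℂ] (H →L[ℂ] H) :=
  (cfcHom (R := ℂ) (a := (U : H →L[ℂ] H)) (Unitary.coe_isStarNormal U)).comp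
    (ContinuousMap.compStarAlgHom' ℂ ℂ (spectrumToCircle U))

/-- The coordinate function `w ↦ w` on the circle. -/
def circleCoord : C(Circle, ℂ) := ⟨fun w => (w : ℂ), by fun_prop⟩

@[simp] lemma circleCoord_apply (w : Circle) : circleCoord w = (w : ℂ) := rfl

lemma circleCalc_circleCoord (U : unitary (H →L[ℂ] H)) : circleCalc U circleCoord = U := by
  conv_rhs => rw [← cfcHom_id (R := ℂ) (Unitary.coe_isStarNormal U)]
  rfl

lemma funCalc_eq_circleCalc (U : unitary (H →L[ℂ] H)) (f : C_c(Circle, ℝ)) :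
    funCalc U f = circleCalc U ⟨fun x => ((f x : ℝ) : ℂ), by fun_prop⟩ := rfl

lemma integral_spectralMeasure (U : unitary (H →L[ℂ] H)) (φ : H) (f : C_c(Circle, ℝ)) :
    ∫ w, f w ∂(spectralMeasure U φ) = (⟪φ, funCalc U f φ⟫_ℂ).re :=
  RealRMK.integral_rieszMeasure (spectralFunctional U φ) f

lemma norm_circleCalc_apply_sq (U : unitary (H →L[ℂ] H)) (φ : H) (f : C(Circle, ℂ)) :
    ‖circleCalc U f φ‖ ^ 2 = ∫ w, ‖f w‖ ^ 2 ∂(spectralMeasure U φ) := by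
  let g : C_c(Circle, ℝ) := ⟨⟨fun w => ‖f w‖ ^ 2, by fun_prop⟩, HasCompactSupport.of_compactSpace _⟩
  have h := integral_spectralMeasure U φ g
  have hg : funCalc U g = star (circleCalc U f) * circleCalc U f := by
    rw [funCalc_eq_circleCalc, ← map_star, ← map_mul]
    congr 1
    ext w
    change (((‖f w‖ ^ 2 : ℝ)) : ℂ) = starRingEnd ℂ (f w) * f w
    rw [← Complex.normSq_eq_conj_mul_self, Complex.normSq_eq_norm_sq]
  rw [hg, mul_apply_eq_comp, ContinuousLinearMap.star_eq_adjoint,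
    ContinuousLinearMap.adjoint_inner_right] at h
  exact (inner_self_eq_norm_sq (𝕜 := ℂ) _).symm.trans h.symm

lemma norm_toLp_eq_norm_circleCalc (U : unitary (H →L[ℂ] H)) (φ : H) (f : C(Circle, ℂ)) :
    ‖ContinuousMap.toLp 2 (spectralMeasure U φ) ℂ f‖ = ‖circleCalc U f φ‖ := by
  have h : ‖ContinuousMap.toLp 2 (spectralMeasure U φ) ℂ f‖ ^ 2 = ‖circleCalc U f φ‖ ^ 2 := by
    rw [norm_circleCalc_apply_sq, ← inner_self_eq_norm_sq (𝕜 := ℂ), L2.inner_def, ← integral_re]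
    · refine integral_congr_ae ?_
      filter_upwards [ContinuousMap.coeFn_toLp (p := 2) (𝕜 := ℂ) (spectralMeasure U φ) f] with w hw
      rw [hw, inner_self_eq_norm_sq (𝕜 := ℂ)]
    · exact L2.integrable_inner _ _
  exact (sq_eq_sq₀ (norm_nonneg _) (norm_nonneg _)).1 h

/-- The isometric embedding `L²(μ) → H` extending `f ↦ f(U) φ`, for `μ` the spectral measure. -/
def spectralEmbedding (U : unitary (H →L[ℂ] H)) (φ : H) :
    Lp ℂ 2 (spectralMeasure U φ) →ₗᵢ[ℂ] H :=
  let A : C(Circle, ℂ) →ₗ[ℂ] H :=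
    (ContinuousLinearMap.apply ℂ H φ).toLinearMap ∘ₗ (circleCalc U).toAlgHom.toLinearMap
  let e : C(Circle, ℂ) →ₗ[ℂ] Lp ℂ 2 (spectralMeasure U φ) :=
    (ContinuousMap.toLp 2 (spectralMeasure U φ) ℂ).toLinearMap
  { toLinearMap := (A.extendOfNorm e).toLinearMap
    norm_map' := by
      have hd : DenseRange e := ContinuousMap.toLp_denseRange ℂ (spectralMeasure U φ) ℂ (by simp)
      have hn : ∀ f, ‖A f‖ ≤ 1 * ‖e f‖ := fun f => by
        rw [one_mul]; exact (norm_toLp_eq_norm_circleCalc U φ f).ge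
      intro x
      refine hd.induction_on (p := fun x => ‖A.extendOfNorm e x‖ = ‖x‖) x
        (isClosed_eq (by fun_prop) (by fun_prop)) fun f => ?_
      rw [LinearMap.extendOfNorm_eq hd ⟨1, hn⟩]
      exact (norm_toLp_eq_norm_circleCalc U φ f).symm }

lemma spectralEmbedding_toLp (U : unitary (H →L[ℂ] H)) (φ : H) (f : C(Circle, ℂ)) :
    spectralEmbedding U φ (ContinuousMap.toLp 2 (spectralMeasure U φ) ℂ f) = circleCalc U f φ := by
  have hd : DenseRange (ContinuousMap.toLp 2 (spectralMeasure U φ) ℂ) :=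
    ContinuousMap.toLp_denseRange ℂ (spectralMeasure U φ) ℂ (by simp)
  exact LinearMap.extendOfNorm_eq (𝕜 := ℂ) (𝕜₂ := ℂ)
    (f := (ContinuousLinearMap.apply ℂ H φ).toLinearMap ∘ₗ (circleCalc U).toAlgHom.toLinearMap)
    (e := (ContinuousMap.toLp 2 (spectralMeasure U φ) ℂ).toLinearMap) hd
    ⟨1, fun f => by rw [one_mul]; exact (norm_toLp_eq_norm_circleCalc U φ f).ge⟩ f

/-- The adjoint `H → L²(μ)` of the spectral embedding: the representation of a vector as a
function on the circle. -/
def spectralRep (U : unitary (H →L[ℂ] H)) (φ : H) : H →L[ℂ] Lp ℂ 2 (spectralMeasure U φ) :=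
  (spectralEmbedding U φ).toContinuousLinearMap.adjoint

lemma inner_spectralEmbedding (U : unitary (H →L[ℂ] H)) (φ x : H)
    (f : Lp ℂ 2 (spectralMeasure U φ)) :
    ⟪spectralEmbedding U φ f, x⟫_ℂ = ⟪f, spectralRep U φ x⟫_ℂ :=
  (ContinuousLinearMap.adjoint_inner_right _ _ _).symm

lemma spectralRep_spectralEmbedding (U : unitary (H →L[ℂ] H)) (φ : H)
    (f : Lp ℂ 2 (spectralMeasure U φ)) :
    spectralRep U φ (spectralEmbedding U φ f) = f := by
  refine ext_inner_left ℂ fun g => ?_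
  rw [← inner_spectralEmbedding, LinearIsometry.inner_map_map]

lemma norm_spectralRep_le (U : unitary (H →L[ℂ] H)) (φ x : H) : ‖spectralRep U φ x‖ ≤ ‖x‖ := by
  have h : ‖spectralRep U φ x‖ ^ 2 ≤ ‖spectralRep U φ x‖ * ‖x‖ := by
    rw [← inner_self_eq_norm_sq (𝕜 := ℂ), ← inner_spectralEmbedding]
    refine (re_inner_le_norm _ _).trans ?_
    rw [LinearIsometry.norm_map]
  rcases (norm_nonneg (spectralRep U φ x)).eq_or_lt with h0 | h0
  · rw [← h0]; exact norm_nonneg _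
  · rw [sq] at h; exact le_of_mul_le_mul_left h h0

lemma inner_circleCalc (U : unitary (H →L[ℂ] H)) (φ x : H) (f : C(Circle, ℂ)) :
    ⟪circleCalc U f φ, x⟫_ℂ = ∫ w, starRingEnd ℂ (f w) * spectralRep U φ x w ∂spectralMeasure U φ := by
  rw [← spectralEmbedding_toLp, inner_spectralEmbedding, L2.inner_def]
  refine integral_congr_ae ?_
  filter_upwards [ContinuousMap.coeFn_toLp (p := 2) (𝕜 := ℂ) (spectralMeasure U φ) f] with w hw
  rw [hw, RCLike.inner_apply, mul_comm]

lemma inner_eq_integral_spectralRep (U : unitary (H →L[ℂ] H)) (φ x : H) :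
    ⟪φ, x⟫_ℂ = ∫ w, spectralRep U φ x w ∂spectralMeasure U φ := by
  simpa using inner_circleCalc U φ x 1

lemma spectralRep_self (U : unitary (H →L[ℂ] H)) (φ : H) :
    spectralRep U φ φ =ᵐ[spectralMeasure U φ] 1 := by
  have h : spectralEmbedding U φ (ContinuousMap.toLp 2 (spectralMeasure U φ) ℂ 1) = φ := by
    rw [spectralEmbedding_toLp]; simp
  have h2 := spectralRep_spectralEmbedding U φ (ContinuousMap.toLp 2 (spectralMeasure U φ) ℂ 1)
  rw [h] at h2
  rw [h2]
  exact ContinuousMap.coeFn_toLp (p := 2) (𝕜 := ℂ) (spectralMeasure U φ) 1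

lemma memLp_circleCoord_mul {μ : Measure Circle} {f : Circle → ℂ} (hf : MemLp f 2 μ) :
    MemLp (fun w : Circle => (w : ℂ) * f w) 2 μ := by
  refine hf.congr_norm ((Continuous.aestronglyMeasurable (by fun_prop)).mul hf.1) ?_
  exact ae_of_all _ fun w => by rw [norm_mul, Circle.norm_coe, one_mul]

/-- Test against the dense continuous f: moving U to the other side of the inner product multiplies
f by the conjugate coordinate. Surjectivity of the embedding, hence cyclicity, is not needed. -/
lemma spectralRep_apply_unitary (U : unitary (H →L[ℂ] H)) (φ x : H) :
    spectralRep U φ ((U : H →L[ℂ] H) x) =ᵐ[spectralMeasure U φ]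
      fun w => (w : ℂ) * spectralRep U φ x w := by
  have hm := memLp_circleCoord_mul (Lp.memLp (spectralRep U φ x))
  suffices h : spectralRep U φ ((U : H →L[ℂ] H) x) = hm.toLp by
    rw [h]; exact hm.coeFn_toLp
  have hd : DenseRange (ContinuousMap.toLp 2 (spectralMeasure U φ) ℂ) :=
    ContinuousMap.toLp_denseRange ℂ (spectralMeasure U φ) ℂ (by simp)
  refine hd.eq_of_inner_right ℂ fun f => ?_
  rw [← inner_spectralEmbedding, spectralEmbedding_toLp]
  have h1 : ⟪circleCalc U f φ, (U : H →L[ℂ] H) x⟫_ℂ =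
      ⟪circleCalc U (star circleCoord * f) φ, x⟫_ℂ := by
    rw [map_mul, map_star, circleCalc_circleCoord, mul_apply_eq_comp,
      ContinuousLinearMap.star_eq_adjoint, ContinuousLinearMap.adjoint_inner_left]
  rw [h1, inner_circleCalc, L2.inner_def]
  refine integral_congr_ae ?_
  filter_upwards [ContinuousMap.coeFn_toLp (p := 2) (𝕜 := ℂ) (spectralMeasure U φ) f,
    hm.coeFn_toLp] with w hw hw'
  rw [hw, hw', RCLike.inner_apply]
  simp
  ring

lemma spectralRep_zpow (U : unitary (H →L[ℂ] H)) (φ x : H) (n : ℤ) :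
    spectralRep U φ (((U ^ n : unitary (H →L[ℂ] H)) : H →L[ℂ] H) x) =ᵐ[spectralMeasure U φ]
      fun w => (w : ℂ) ^ n * spectralRep U φ x w := by
  have key : ∀ k : ℤ, ((U ^ (k + 1) : unitary (H →L[ℂ] H)) : H →L[ℂ] H) x =
      (U : H →L[ℂ] H) (((U ^ k : unitary (H →L[ℂ] H)) : H →L[ℂ] H) x) := fun k => by
    rw [add_comm, zpow_add, zpow_one]; rfl
  induction n with
  | zero => simp
  | succ k ih =>
    rw [key]
    filter_upwards [ih, spectralRep_apply_unitary U φ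
      (((U ^ (k : ℤ) : unitary (H →L[ℂ] H)) : H →L[ℂ] H) x)] with w h1 h2
    rw [h2, h1, zpow_add₀ w.coe_ne_zero, zpow_one]
    ring
  | pred k ih =>
    have h := key (-(k : ℤ) - 1)
    rw [sub_add_cancel] at h
    rw [h] at ih
    filter_upwards [ih, spectralRep_apply_unitary U φ
      (((U ^ (-(k : ℤ) - 1) : unitary (H →L[ℂ] H)) : H →L[ℂ] H) x)] with w h1 h2
    refine mul_left_cancel₀ w.coe_ne_zero ?_
    rw [← h2, h1, zpow_sub_one₀ w.coe_ne_zero]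
    field_simp [w.coe_ne_zero]

lemma inner_zpow_eq_integral (U : unitary (H →L[ℂ] H)) (φ x : H) (n : ℤ) :
    ⟪φ, ((U ^ n : unitary (H →L[ℂ] H)) : H →L[ℂ] H) x⟫_ℂ =
      ∫ w : Circle, (w : ℂ) ^ n * spectralRep U φ x w ∂spectralMeasure U φ := by
  rw [inner_eq_integral_spectralRep U]
  exact integral_congr_ae (spectralRep_zpow U φ x n)

lemma integral_zpow_spectralMeasure (U : unitary (H →L[ℂ] H)) (φ : H) (n : ℤ) :
    ∫ w : Circle, (w : ℂ) ^ n ∂spectralMeasure U φ =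
      ⟪φ, ((U ^ n : unitary (H →L[ℂ] H)) : H →L[ℂ] H) φ⟫_ℂ := by
  rw [inner_zpow_eq_integral]
  refine integral_congr_ae ?_
  filter_upwards [spectralRep_self U φ] with w hw
  simp [hw]

lemma isProbabilityMeasure_spectralMeasure (U : unitary (H →L[ℂ] H)) {φ : H} (hφ : ‖φ‖ = 1) :
    IsProbabilityMeasure (spectralMeasure U φ) := by
  have h := integral_zpow_spectralMeasure U φ 0
  simp [inner_self_eq_norm_sq_to_K, hφ] at h
  refine ⟨?_⟩
  rw [Measure.real] at h
  norm_cast at h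
  exact (ENNReal.toReal_eq_one_iff _).1 h

/-- Since U is onto, it suffices to pair with Uy; U then cancels on the left and the factors w and
conj w cancel on the right. -/
lemma unitary_spectralEmbedding (U : unitary (H →L[ℂ] H)) (φ : H) {f : Circle → ℂ}
    (hf : MemLp f 2 (spectralMeasure U φ)) :
    (U : H →L[ℂ] H) (spectralEmbedding U φ hf.toLp) =
      spectralEmbedding U φ (memLp_circleCoord_mul hf).toLp := by
  refine ext_inner_right ℂ fun x => ?_
  obtain ⟨y, rfl⟩ : ∃ y, (U : H →L[ℂ] H) y = x :=
    ⟨((U⁻¹ : unitary (H →L[ℂ] H)) : H →L[ℂ] H) x, by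
      change ((U * U⁻¹ : unitary (H →L[ℂ] H)) : H →L[ℂ] H) x = x
      simp⟩
  have h1 : ⟪(U : H →L[ℂ] H) (spectralEmbedding U φ hf.toLp), (U : H →L[ℂ] H) y⟫_ℂ =
      ⟪spectralEmbedding U φ hf.toLp, y⟫_ℂ := by
    rw [← ContinuousLinearMap.adjoint_inner_left, ← ContinuousLinearMap.star_eq_adjoint,
      ← mul_apply_eq_comp, Unitary.coe_star_mul_self]
    rfl
  rw [h1, inner_spectralEmbedding, inner_spectralEmbedding, L2.inner_def, L2.inner_def]
  refine integral_congr_ae ?_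
  filter_upwards [hf.coeFn_toLp, (memLp_circleCoord_mul hf).coeFn_toLp,
    spectralRep_apply_unitary U φ y] with w h2 h3 h4
  rw [h2, h3, h4, RCLike.inner_apply, RCLike.inner_apply]
  have : (w : ℂ) * starRingEnd ℂ (w : ℂ) = 1 := by
    rw [Complex.mul_conj, Complex.normSq_eq_norm_sq, Circle.norm_coe]; simp
  simp only [map_mul]
  linear_combination (-spectralRep U φ y w * starRingEnd ℂ (f w)) * this

/-- For a cyclic vector the spectral representation is injective. -/
lemma IsCyclic.spectralRep_injective {U : unitary (H →L[ℂ] H)} {φ : H} (hcyc : IsCyclic U φ)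
    {x : H} (hx : spectralRep U φ x =ᵐ[spectralMeasure U φ] 0) : x = 0 := by
  have h : x ∈ (Submodule.span ℂ (Set.range fun k : ℤ =>
      ((U ^ k : unitary (H →L[ℂ] H)) : H →L[ℂ] H) φ))ᗮ := by
    rw [Submodule.mem_orthogonal]
    intro u hu
    induction hu using Submodule.span_induction with
    | zero => simp
    | add a b _ _ ha hb => rw [inner_add_left, ha, hb, add_zero]
    | smul c a _ ha => rw [inner_smul_left, ha, mul_zero]
    | mem a ha =>
      obtain ⟨k, rfl⟩ := ha
      have h1 : ⟪((U ^ k : unitary (H →L[ℂ] H)) : H →L[ℂ] H) φ, x⟫_ℂ =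
          ⟪φ, ((U ^ (-k) : unitary (H →L[ℂ] H)) : H →L[ℂ] H) x⟫_ℂ := by
        rw [zpow_neg, ← ContinuousLinearMap.adjoint_inner_right,
          ← ContinuousLinearMap.star_eq_adjoint]
        rfl
      rw [h1, inner_zpow_eq_integral]
      refine integral_eq_zero_of_ae ?_
      filter_upwards [hx] with w hw
      simp [hw]
  rwa [(Submodule.topologicalClosure_eq_top_iff).1 hcyc, Submodule.mem_bot] at h

/-! ### The quadratic potential of a measure -/

lemma _root_.Circle.norm_exp_sub_exp_le (a b : ℝ) :
    ‖(Circle.exp a : ℂ) - (Circle.exp b : ℂ)‖ ≤ |a - b| := by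
  have h : (Circle.exp a : ℂ) - (Circle.exp b : ℂ) =
      (Circle.exp b : ℂ) * (Complex.exp (Complex.I * ((a - b : ℝ) : ℂ)) - 1) := by
    rw [mul_sub, mul_one, Circle.coe_exp, Circle.coe_exp, ← Complex.exp_add]
    push_cast
    ring_nf
  rw [h, norm_mul, Circle.norm_coe, one_mul, mul_comm Complex.I]
  simpa [mul_comm] using Real.norm_exp_I_mul_ofReal_sub_one_le (x := a - b)

lemma measurable_inv_enorm_sub_sq :
    Measurable fun q : Circle × Circle => (‖(q.1 : ℂ) - (q.2 : ℂ)‖ₑ ^ 2)⁻¹ := by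
  have : Continuous fun q : Circle × Circle => (q.1 : ℂ) - (q.2 : ℂ) := by fun_prop
  exact (this.enorm.measurable.pow_const 2).inv

lemma measurable_inv_enorm_sub_sq_right (z : Circle) :
    Measurable fun w : Circle => (‖(z : ℂ) - (w : ℂ)‖ₑ ^ 2)⁻¹ := by
  have : Continuous fun w : Circle => (z : ℂ) - (w : ℂ) := by fun_prop
  exact (this.enorm.measurable.pow_const 2).inv

/-- A finite measure on the circle does not charge the set where its quadratic potential
`∫ |z - w|⁻² dμ(w)` is finite. -/
lemma measure_setOf_lintegral_inv_sq_lt_top (μ : Measure Circle) [IsFiniteMeasure μ] :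
    μ {z : Circle | ∫⁻ w : Circle, (‖(z : ℂ) - (w : ℂ)‖ₑ ^ 2)⁻¹ ∂μ < ∞} = 0 := by
  set P : Circle → ℝ≥0∞ := fun z => ∫⁻ w : Circle, (‖(z : ℂ) - (w : ℂ)‖ₑ ^ 2)⁻¹ ∂μ
  have hsub : {z | P z < ∞} ⊆ ⋃ M : ℕ, {z | P z ≤ M} := fun z hz => by
    obtain ⟨M, hM⟩ := ENNReal.exists_nat_gt (ne_of_lt hz)
    exact Set.mem_iUnion.2 ⟨M, hM.le⟩
  refine measure_mono_null hsub (measure_iUnion_null fun M => ?_)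
  -- Cut the circle into n arcs of length d = 2π/n. An arc meeting {P ≤ M} has mass at most M d², so
  -- {P ≤ M} has mass at most n M d², which is of order 1/n.
  have hbound : ∀ n : ℕ, 0 < n →
      μ {z | P z ≤ M} ≤ ENNReal.ofReal (M * (2 * Real.pi) ^ 2 / n) := by
    intro n hn
    have hn' : (0 : ℝ) < n := by exact_mod_cast hn
    set d : ℝ := 2 * Real.pi / n with hd
    have hd0 : 0 < d := by positivity
    let A : ℕ → Set Circle := fun k => Circle.exp '' Set.Icc (k * d) ((k + 1) * d)
    have hcov : {z | P z ≤ M} ⊆ ⋃ k ∈ Finset.range n, {z | P z ≤ M} ∩ A k := by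
      intro z hz
      obtain ⟨t, ht, rfl⟩ : ∃ t ∈ Set.Ico (0 : ℝ) (2 * Real.pi), Circle.exp t = z := by
        obtain ⟨s, rfl⟩ := Circle.exp_surjective z
        refine ⟨toIcoMod Real.two_pi_pos 0 s, by simpa using toIcoMod_mem_Ico Real.two_pi_pos 0 s, ?_⟩
        rw [toIcoMod, zsmul_eq_mul, Circle.periodic_exp.sub_int_mul_eq]
      have h0 : 0 ≤ t / d := div_nonneg ht.1 hd0.le
      have h1 : t / d < n := by
        rw [div_lt_iff₀ hd0, hd, mul_div_cancel₀ _ hn'.ne']; exact ht.2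
      refine Set.mem_biUnion (x := ⌊t / d⌋₊) (by simpa [Nat.floor_lt h0] using h1)
        ⟨hz, t, ⟨?_, ?_⟩, rfl⟩
      · rw [← le_div_iff₀ hd0]; exact Nat.floor_le h0
      · rw [← div_le_iff₀ hd0]; exact (Nat.lt_floor_add_one _).le
    have hone : ∀ k, μ ({z | P z ≤ M} ∩ A k) ≤ ENNReal.ofReal (M * d ^ 2) := by
      intro k
      rcases ({z | P z ≤ M} ∩ A k).eq_empty_or_nonempty with he | ⟨z, hz, hzA⟩
      · simp [he]
      · refine (measure_mono Set.inter_subset_right).trans ?_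
        obtain ⟨a, ha, rfl⟩ := hzA
        -- On the arc the integrand of P at the chosen point is at least d⁻², so Markov's inequality
        -- bounds the mass of the arc.
        have hsub : A k ⊆ {w : Circle | (ENNReal.ofReal (d ^ 2))⁻¹ ≤
            (‖((Circle.exp a : Circle) : ℂ) - (w : ℂ)‖ₑ ^ 2)⁻¹} := by
          rintro _ ⟨b, hb, rfl⟩
          refine ENNReal.inv_le_inv.2 ?_
          rw [ENNReal.ofReal_pow hd0.le, ← ofReal_norm]
          gcongr
          refine (Circle.norm_exp_sub_exp_le a b).trans ?_
          rw [abs_le]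
          constructor <;> nlinarith [ha.1, ha.2, hb.1, hb.2]
        refine (measure_mono hsub).trans ?_
        have hpos : ENNReal.ofReal (d ^ 2) ≠ 0 := by simpa using hd0.ne'
        refine (meas_ge_le_lintegral_div (measurable_inv_enorm_sub_sq_right _).aemeasurable
          (ENNReal.inv_ne_zero.2 ENNReal.ofReal_ne_top) (ENNReal.inv_ne_top.2 hpos)).trans ?_
        rw [div_eq_mul_inv, inv_inv, ENNReal.ofReal_mul (Nat.cast_nonneg M), ENNReal.ofReal_natCast]
        gcongr
        exact hz
    calc μ {z | P z ≤ M} ≤ ∑ k ∈ Finset.range n, μ ({z | P z ≤ M} ∩ A k) :=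
          (measure_mono hcov).trans (measure_biUnion_finset_le _ _)
      _ ≤ ∑ k ∈ Finset.range n, ENNReal.ofReal (M * d ^ 2) := Finset.sum_le_sum fun k _ => hone k
      _ = ENNReal.ofReal (M * (2 * Real.pi) ^ 2 / n) := by
          rw [Finset.sum_const, Finset.card_range, nsmul_eq_mul, ← ENNReal.ofReal_natCast,
            ← ENNReal.ofReal_mul hn'.le, hd]
          congr 1
          field_simp
  have hlim : Tendsto (fun n : ℕ => ENNReal.ofReal (M * (2 * Real.pi) ^ 2 / n)) atTop (𝓝 0) := by
    rw [← ENNReal.ofReal_zero]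
    exact ENNReal.tendsto_ofReal (tendsto_const_div_atTop_nhds_zero_nat _)
  refine le_antisymm (ge_of_tendsto hlim ?_) zero_le
  filter_upwards [eventually_gt_atTop 0] with n hn using hbound n hn

lemma measurable_G (U : unitary (H →L[ℂ] H)) (φ : H) : Measurable (G U φ) :=
  measurable_inv_enorm_sub_sq.lintegral_prod_right'

lemma ae_ne_of_G_lt_top {U : unitary (H →L[ℂ] H)} {φ : H} {z : Circle} (hz : G U φ z < ∞) :
    ∀ᵐ w ∂spectralMeasure U φ, w ≠ z := by
  filter_upwards [ae_lt_top (measurable_inv_enorm_sub_sq_right z) hz.ne] with w hw h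
  simp [h] at hw

lemma memLp_inv_sub_of_G_lt_top {U : unitary (H →L[ℂ] H)} {φ : H} {z : Circle}
    (hz : G U φ z < ∞) :
    MemLp (fun w : Circle => ((w : ℂ) - z)⁻¹) 2 (spectralMeasure U φ) := by
  have hm : Measurable fun w : Circle => ((w : ℂ) - z)⁻¹ :=
    Measurable.inv (Continuous.measurable (by fun_prop))
  refine ⟨hm.aestronglyMeasurable, ?_⟩
  rw [eLpNorm_lt_top_iff_lintegral_rpow_enorm_lt_top (by simp) (by simp)]
  refine lt_of_le_of_lt (lintegral_mono_ae ?_) hz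
  filter_upwards [ae_ne_of_G_lt_top hz] with w hw
  have hne : (w : ℂ) - z ≠ 0 := sub_ne_zero.2 fun h => hw (Circle.coe_injective h)
  rw [enorm_inv hne, enorm_sub_rev, ENNReal.toReal_ofNat, ENNReal.rpow_two, ENNReal.inv_pow]

/-- In the spectral representation the equation reads (w - z) x(w) = c w, so |w - z|⁻² =
|x(w)|²/|c|² is integrable. This is the converse of the construction of `poleVector`. -/
lemma G_lt_top_of_sub_eq_smul {U : unitary (H →L[ℂ] H)} {φ x : H} {z : Circle} {c : ℂ}
    (hc : c ≠ 0) (hx : (U : H →L[ℂ] H) x - (z : ℂ) • x = c • (U : H →L[ℂ] H) φ) :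
    G U φ z < ∞ := by
  have h := (Lp.memLp (spectralRep U φ x)).2
  rw [eLpNorm_lt_top_iff_lintegral_rpow_enorm_lt_top (by simp) (by simp)] at h
  have h2 : ∫⁻ w : Circle, (‖c‖ₑ⁻¹) ^ 2 * ‖spectralRep U φ x w‖ₑ ^ 2 ∂spectralMeasure U φ < ∞ := by
    rw [lintegral_const_mul' _ _ (by finiteness [enorm_ne_zero.2 hc])]
    refine ENNReal.mul_lt_top (by finiteness [enorm_ne_zero.2 hc]) ?_
    simpa using h
  refine lt_of_le_of_lt (lintegral_mono_ae ?_) h2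
  have h3 := congrArg (spectralRep U φ) hx
  rw [map_sub, map_smul, map_smul] at h3
  have h4 := Lp.coeFn_sub (spectralRep U φ ((U : H →L[ℂ] H) x)) ((z : ℂ) • spectralRep U φ x)
  rw [h3] at h4
  filter_upwards [h4, Lp.coeFn_smul (z : ℂ) (spectralRep U φ x),
    Lp.coeFn_smul c (spectralRep U φ ((U : H →L[ℂ] H) φ)),
    spectralRep_apply_unitary U φ x, spectralRep_apply_unitary U φ φ,
    spectralRep_self U φ] with w e1 e2 e3 e4 e5 e6
  simp only [e3, Pi.smul_apply, Pi.sub_apply, e2, e4, e5, e6, Pi.one_apply, smul_eq_mul,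
    mul_one, ← sub_mul] at e1
  have h5 : ‖c‖ₑ = ‖(z : ℂ) - w‖ₑ * ‖spectralRep U φ x w‖ₑ := by
    rw [enorm_sub_rev, ← enorm_mul, ← e1, enorm_mul]
    have : ‖(w : ℂ)‖ₑ = 1 := by rw [← ofReal_norm, Circle.norm_coe]; simp
    rw [this, mul_one]
  have h6 : ‖(z : ℂ) - w‖ₑ ≠ 0 := by
    intro h0
    rw [h0, zero_mul] at h5
    exact hc (enorm_eq_zero.1 h5)
  rw [ENNReal.inv_pow, ← mul_pow]
  gcongr
  rw [h5, ENNReal.mul_inv (Or.inl h6) (Or.inl enorm_ne_top), mul_assoc]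
  refine le_mul_of_one_le_right' ?_
  rw [ENNReal.inv_mul_cancel _ enorm_ne_top]
  intro h0
  rw [h0, mul_zero] at h5
  exact hc (enorm_eq_zero.1 h5)

/-! ### Pole vectors and radial limits -/

lemma memLp_div_sub_of_G_lt_top {U : unitary (H →L[ℂ] H)} {φ : H} {z : Circle}
    (hz : G U φ z < ∞) :
    MemLp (fun w : Circle => (w : ℂ) * ((w : ℂ) - z)⁻¹) 2 (spectralMeasure U φ) :=
  memLp_circleCoord_mul (memLp_inv_sub_of_G_lt_top hz)

lemma spectralEmbedding_one (U : unitary (H →L[ℂ] H)) (φ : H) :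
    spectralEmbedding U φ (memLp_const (1 : ℂ)).toLp = φ := by
  have h := spectralEmbedding_toLp U φ 1
  rw [map_one (circleCalc U), one_apply_eq_self] at h
  exact h

/-- The solution `V (w / (w - z))` of `(U - z) v = U φ`, where `G(z) < ∞`. -/
def poleVector {U : unitary (H →L[ℂ] H)} {φ : H} {z : Circle} (hz : G U φ z < ∞) : H :=
  spectralEmbedding U φ (memLp_div_sub_of_G_lt_top hz).toLp

lemma unitary_poleVector {U : unitary (H →L[ℂ] H)} {φ : H} {z : Circle} (hz : G U φ z < ∞) :
    (U : H →L[ℂ] H) (poleVector hz) = (z : ℂ) • poleVector hz + (U : H →L[ℂ] H) φ := by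
  have h : (U : H →L[ℂ] H) φ =
      (U : H →L[ℂ] H) (spectralEmbedding U φ (memLp_const (1 : ℂ)).toLp) := by
    rw [spectralEmbedding_one]
  rw [h, poleVector, unitary_spectralEmbedding, unitary_spectralEmbedding, ← map_smul, ← map_add,
    ← MemLp.toLp_const_smul, ← MemLp.toLp_add]
  congr 1
  refine MemLp.toLp_congr _ _ ?_
  filter_upwards [ae_ne_of_G_lt_top hz] with w hw
  have hne : (w : ℂ) - z ≠ 0 := sub_ne_zero.2 fun h => hw (Circle.coe_injective h)
  simp only [Pi.add_apply, Pi.smul_apply, smul_eq_mul]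
  field_simp
  ring

/-- On the unit circle the conjugate of w/(w - z) is -z/(w - z). -/
lemma inner_poleVector {U : unitary (H →L[ℂ] H)} {φ : H} {z : Circle} (hz : G U φ z < ∞) (x : H) :
    ⟪poleVector hz, x⟫_ℂ =
      -∫ w : Circle, (z : ℂ) * ((w : ℂ) - z)⁻¹ * spectralRep U φ x w ∂spectralMeasure U φ := by
  rw [poleVector, inner_spectralEmbedding, L2.inner_def, ← integral_neg]
  refine integral_congr_ae ?_
  filter_upwards [ae_ne_of_G_lt_top hz, (memLp_div_sub_of_G_lt_top hz).coeFn_toLp] with w hw h1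
  have hne : (w : ℂ) - z ≠ 0 := sub_ne_zero.2 fun h => hw (Circle.coe_injective h)
  have hne' : (z : ℂ) - w ≠ 0 := by rw [← neg_sub]; exact neg_ne_zero.2 hne
  have hne2 : (w : ℂ)⁻¹ - (z : ℂ)⁻¹ ≠ 0 := by
    rw [inv_sub_inv w.coe_ne_zero z.coe_ne_zero]
    exact div_ne_zero hne' (mul_ne_zero w.coe_ne_zero z.coe_ne_zero)
  rw [h1, RCLike.inner_apply, map_mul, map_inv₀, map_sub, ← Circle.coe_inv_eq_conj,
    ← Circle.coe_inv_eq_conj, Circle.coe_inv, Circle.coe_inv, inv_sub_inv w.coe_ne_zero z.coe_ne_zero]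
  have := w.coe_ne_zero
  have := z.coe_ne_zero
  rw [← neg_sub (z : ℂ) w] at *
  field_simp

lemma isUnit_sub_smul_one (U : unitary (H →L[ℂ] H)) {z : ℂ} (hz : ‖z‖ < 1) :
    IsUnit ((U : H →L[ℂ] H) - z • 1) := by
  have h : z ∉ spectrum ℂ (U : H →L[ℂ] H) := fun h => by
    have := Unitary.spectrum_subset_circle (𝕜 := ℂ) U h
    simp at this
    exact hz.ne this
  rw [spectrum.notMem_iff, Algebra.algebraMap_eq_smul_one] at h
  simpa using h.neg

lemma carath_eq_integral (U : unitary (H →L[ℂ] H)) (φ ψ : H) {z : ℂ} (hz : ‖z‖ < 1) :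
    carath U φ ψ z =
      ∫ w : Circle, ((w : ℂ) + z) * ((w : ℂ) - z)⁻¹ * spectralRep U φ ψ w ∂spectralMeasure U φ := by
  set y := Ring.inverse ((U : H →L[ℂ] H) - z • 1) ψ with hy
  have h1 : (U : H →L[ℂ] H) y - z • y = ψ := by
    have := congrArg (fun A : H →L[ℂ] H => A ψ) (Ring.mul_inverse_cancel _ (isUnit_sub_smul_one U hz))
    simpa [hy] using this
  have h2 : carath U φ ψ z = ⟪φ, (U : H →L[ℂ] H) y + z • y⟫_ℂ := by
    simp [carath, hy]
  rw [h2, inner_eq_integral_spectralRep U, map_add, map_smul]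
  refine integral_congr_ae ?_
  have h3 := congrArg (spectralRep U φ) h1
  rw [map_sub, map_smul] at h3
  have h4 := Lp.coeFn_sub (spectralRep U φ ((U : H →L[ℂ] H) y)) (z • spectralRep U φ y)
  rw [h3] at h4
  filter_upwards [h4, Lp.coeFn_smul z (spectralRep U φ y), spectralRep_apply_unitary U φ y,
    Lp.coeFn_add (spectralRep U φ ((U : H →L[ℂ] H) y)) (z • spectralRep U φ y)] with w e1 e2 e3 e4
  have hne : (w : ℂ) - z ≠ 0 := sub_ne_zero.2 fun h => by
    rw [← h, Circle.norm_coe] at hz; exact lt_irrefl _ hz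
  rw [e4, e1]
  simp only [Pi.add_apply, Pi.sub_apply, e2, e3, Pi.smul_apply, smul_eq_mul]
  field_simp

/-- Where `G(z) < ∞`, the function `⟨φ, (U + ·) (U - ·)⁻¹ ψ⟩` has a radial limit. -/
lemma tendsto_carath {U : unitary (H →L[ℂ] H)} {φ ψ : H} (hψφ : ⟪φ, ψ⟫_ℂ = 0) {z : Circle}
    (hz : G U φ z < ∞) :
    Tendsto (fun r : ℝ => carath U φ ψ ((r : ℂ) * (z : ℂ))) (𝓝[<] (1 : ℝ))
      (𝓝 (-2 * ⟪poleVector hz, ψ⟫_ℂ)) := by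
  have hint : Integrable (fun w : Circle => ((w : ℂ) - z)⁻¹ * spectralRep U φ ψ w)
      (spectralMeasure U φ) :=
    (memLp_inv_sub_of_G_lt_top hz).integrable_mul (Lp.memLp _)
  have hint' : Integrable (spectralRep U φ ψ) (spectralMeasure U φ) :=
    (Lp.memLp (spectralRep U φ ψ)).integrable one_le_two
  have hlim : -2 * ⟪poleVector hz, ψ⟫_ℂ = ∫ w : Circle,
      ((w : ℂ) + z) * ((w : ℂ) - z)⁻¹ * spectralRep U φ ψ w ∂spectralMeasure U φ := by
    have h0 := inner_eq_integral_spectralRep U φ ψ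
    rw [hψφ] at h0
    -- Orthogonality enters here: ∫ψ dμ = ⟨φ, ψ⟩ = 0 may be added, and 2z/(w - z) + 1 = (w + z)/(w -
    -- z).
    rw [inner_poleVector, neg_mul_neg, ← integral_const_mul,
      ← add_zero (∫ w : Circle, _ ∂_), h0, ← integral_add]
    · refine integral_congr_ae ?_
      filter_upwards [ae_ne_of_G_lt_top hz] with w hw
      have hne : (w : ℂ) - z ≠ 0 := sub_ne_zero.2 fun h => hw (Circle.coe_injective h)
      field_simp
      ring
    · convert hint.const_mul (2 * (z : ℂ)) using 2
      ring
    · exact hint'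
  rw [hlim]
  have hcarath : ∀ᶠ r : ℝ in 𝓝[<] (1 : ℝ), ∫ w : Circle, ((w : ℂ) + r * z) *
      ((w : ℂ) - r * z)⁻¹ * spectralRep U φ ψ w ∂spectralMeasure U φ =
      carath U φ ψ ((r : ℂ) * (z : ℂ)) := by
    filter_upwards [Ioo_mem_nhdsLT (show (-1 : ℝ) < 1 by norm_num)] with r hr
    refine (carath_eq_integral U φ ψ ?_).symm
    rw [norm_mul, Circle.norm_coe, mul_one, Complex.norm_real, Real.norm_eq_abs, abs_lt]
    exact hr
  refine Tendsto.congr' hcarath ?_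
  -- The 4 is the product of |w + rz| ≤ 2 and |w - z| ≤ 2|w - rz|; the latter holds because 1 - r ≤
  -- |w - rz|.
  refine tendsto_integral_filter_of_dominated_convergence
    (fun w => 4 * ‖((w : ℂ) - z)⁻¹ * spectralRep U φ ψ w‖) ?_ ?_ (hint.norm.const_mul 4) ?_
  · refine Eventually.of_forall fun r => ?_
    refine AEStronglyMeasurable.mul (Measurable.aestronglyMeasurable ?_) (Lp.aestronglyMeasurable _)
    exact Measurable.mul (Continuous.measurable (by fun_prop))
      (Measurable.inv (Continuous.measurable (by fun_prop)))
  · filter_upwards [Ioo_mem_nhdsLT (show (0 : ℝ) < 1 by norm_num)] with r hr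
    filter_upwards [ae_ne_of_G_lt_top hz] with w hw
    have hne : (w : ℂ) - z ≠ 0 := sub_ne_zero.2 fun h => hw (Circle.coe_injective h)
    have hr1 : ‖(r : ℂ) * z‖ = r := by
      rw [norm_mul, Circle.norm_coe, mul_one, Complex.norm_real, Real.norm_eq_abs, abs_of_pos hr.1]
    have hnum : ‖(w : ℂ) + r * z‖ ≤ 2 := by
      refine (norm_add_le _ _).trans ?_
      rw [Circle.norm_coe, hr1]
      linarith [hr.2]
    have h1 : 1 - r ≤ ‖(w : ℂ) - r * z‖ := by
      have := norm_sub_norm_le (w : ℂ) (r * z)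
      rwa [Circle.norm_coe, hr1] at this
    have h2 : ‖(w : ℂ) - z‖ ≤ 2 * ‖(w : ℂ) - r * z‖ := by
      have h3 : (w : ℂ) - z = ((w : ℂ) - r * z) + ((r - 1 : ℝ) : ℂ) * z := by push_cast; ring
      have h4 : ‖((r - 1 : ℝ) : ℂ) * z‖ = 1 - r := by
        rw [norm_mul, Circle.norm_coe, mul_one, Complex.norm_real, Real.norm_eq_abs,
          abs_of_neg (by linarith [hr.2])]
        ring
      calc ‖(w : ℂ) - z‖ ≤ ‖(w : ℂ) - r * z‖ + (1 - r) := by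
            rw [h3, ← h4]; exact norm_add_le _ _
        _ ≤ _ := by linarith
    have hpos : 0 < ‖(w : ℂ) - z‖ := norm_pos_iff.2 hne
    have h5 : ‖(w : ℂ) - r * z‖⁻¹ ≤ 2 * ‖(w : ℂ) - z‖⁻¹ := by
      rw [← div_eq_mul_inv, inv_le_comm₀ (by linarith) (by positivity), inv_div]
      linarith
    rw [norm_mul, norm_mul, norm_mul, norm_inv, norm_inv, ← mul_assoc]
    refine mul_le_mul_of_nonneg_right ?_ (norm_nonneg _)
    calc ‖(w : ℂ) + r * z‖ * ‖(w : ℂ) - r * z‖⁻¹ ≤ 2 * (2 * ‖(w : ℂ) - z‖⁻¹) := by gcongr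
      _ = _ := by ring
  · filter_upwards [ae_ne_of_G_lt_top hz] with w hw
    have hne : (w : ℂ) - z ≠ 0 := sub_ne_zero.2 fun h => hw (Circle.coe_injective h)
    have hc : ContinuousAt (fun r : ℝ => ((w : ℂ) + r * z) * ((w : ℂ) - r * z)⁻¹ *
        spectralRep U φ ψ w) 1 := by
      refine ContinuousAt.mul (ContinuousAt.mul (by fun_prop) (ContinuousAt.inv₀ (by fun_prop) ?_))
        continuousAt_const
      simpa using hne
    simpa using hc.tendsto.mono_left nhdsWithin_le_nhds

/-! ### Eigenvectors and atoms of the perturbed operator -/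

lemma coe_perturb (U : unitary (H →L[ℂ] H)) (φ : H) (hφ : ‖φ‖ = 1) (l : Circle) :
    (perturb U φ hφ l : H →L[ℂ] H) = U * ((1 - proj φ) + (l : ℂ) • proj φ) := rfl

lemma perturb_apply (U : unitary (H →L[ℂ] H)) {φ : H} (hφ : ‖φ‖ = 1) (l : Circle) (x : H) :
    (perturb U φ hφ l : H →L[ℂ] H) x =
      (U : H →L[ℂ] H) x - ((1 - (l : ℂ)) * ⟪φ, x⟫_ℂ) • (U : H →L[ℂ] H) φ := by
  simp only [coe_perturb, mul_apply_eq_comp, add_apply,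
    sub_apply, smul_apply, one_apply_eq_self, proj_apply,
    map_add, map_sub, map_smul]
  module

lemma perturb_apply_self (U : unitary (H →L[ℂ] H)) {φ : H} (hφ : ‖φ‖ = 1) (l : Circle) :
    (perturb U φ hφ l : H →L[ℂ] H) φ = (l : ℂ) • (U : H →L[ℂ] H) φ := by
  rw [perturb_apply, inner_self_eq_norm_sq_to_K, hφ]
  simp
  module

lemma spectralRep_eq_zero_of_eigenvector {U : unitary (H →L[ℂ] H)} {φ k : H} {z : Circle}
    (hk : (U : H →L[ℂ] H) k = (z : ℂ) • k) :
    ∀ᵐ w ∂spectralMeasure U φ, w ≠ z → spectralRep U φ k w = 0 := by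
  have h := spectralRep_apply_unitary U φ k
  rw [hk, map_smul] at h
  filter_upwards [h, Lp.coeFn_smul (z : ℂ) (spectralRep U φ k)] with w h1 h2 hw
  rw [h2, Pi.smul_apply, smul_eq_mul, ← sub_eq_zero, ← sub_mul] at h1
  refine (mul_eq_zero.1 h1).resolve_left (sub_ne_zero.2 fun h => hw (Circle.coe_injective h.symm))

/-- The representation of an eigenvector lives on {z}, which is a null set when G(z) < ∞; cyclicity
then makes the vector zero. -/
lemma IsCyclic.eq_zero_of_eigenvector {U : unitary (H →L[ℂ] H)} {φ k : H} (hcyc : IsCyclic U φ)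
    {z : Circle} (hz : G U φ z < ∞) (hk : (U : H →L[ℂ] H) k = (z : ℂ) • k) : k = 0 := by
  refine hcyc.spectralRep_injective ?_
  filter_upwards [ae_ne_of_G_lt_top hz, spectralRep_eq_zero_of_eigenvector (φ := φ) hk]
    with w h1 h2 using h2 h1

lemma spectralMeasure_singleton_ne_zero {U : unitary (H →L[ℂ] H)} {φ v : H} {z : Circle}
    (hv : (U : H →L[ℂ] H) v = (z : ℂ) • v) (hφv : ⟪φ, v⟫_ℂ ≠ 0) :
    spectralMeasure U φ {z} ≠ 0 := by
  intro h0
  refine hφv ?_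
  rw [inner_eq_integral_spectralRep U]
  refine integral_eq_zero_of_ae ?_
  have h1 : ∀ᵐ w ∂spectralMeasure U φ, w ≠ z := by
    rw [ae_iff]
    simpa using h0
  filter_upwards [h1, spectralRep_eq_zero_of_eigenvector (φ := φ) hv] with w h1 h2 using h2 h1

/-- At an atom `z` of the spectral measure of the perturbed operator with `G(z) < ∞`, the
representation of `ψ` is given by the pole vector of the unperturbed operator. -/
lemma spectralRep_perturb_of_atom {U : unitary (H →L[ℂ] H)} {φ : H} (hφ : ‖φ‖ = 1)
    (hcyc : IsCyclic U φ) {z : Circle} (hz : G U φ z < ∞) {l : Circle}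
    (hatom : spectralMeasure (perturb U φ hφ l) φ {z} ≠ 0) (ψ : H) :
    spectralRep (perturb U φ hφ l) φ ψ z =
      starRingEnd ℂ (1 - (l : ℂ)) * ⟪poleVector hz, ψ⟫_ℂ := by
  set W := perturb U φ hφ l with hW
  set m := (spectralMeasure W φ).real {z} with hm
  have hm0 : (m : ℂ) ≠ 0 := by
    rw [Complex.ofReal_ne_zero, hm, Measure.real, ENNReal.toReal_ne_zero]
    exact ⟨hatom, measure_ne_top _ _⟩
  have hmem : MemLp (Set.indicator {z} fun _ => (1 : ℂ)) 2 (spectralMeasure W φ) :=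
    memLp_indicator_const 2 (measurableSet_singleton z) 1 (Or.inr (measure_ne_top _ _))
  -- The indicator of the atom embeds as an eigenvector u of W, and pairing with u reads off values
  -- at z.
  set u := spectralEmbedding W φ hmem.toLp with hu
  have hinner : ∀ x : H, ⟪u, x⟫_ℂ = m * spectralRep W φ x z := by
    intro x
    rw [hu, inner_spectralEmbedding, L2.inner_def]
    have : ∫ w, ⟪(hmem.toLp : Circle → ℂ) w, spectralRep W φ x w⟫_ℂ ∂spectralMeasure W φ =
        ∫ w, Set.indicator {z} (spectralRep W φ x) w ∂spectralMeasure W φ := by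
      refine integral_congr_ae ?_
      filter_upwards [hmem.coeFn_toLp] with w hw
      rw [hw]
      by_cases h : w = z
      · simp [h]
      · simp [h]
    rw [this, integral_indicator (measurableSet_singleton z), integral_singleton]
    rfl
  have hWu : (W : H →L[ℂ] H) u = (z : ℂ) • u := by
    rw [hu, unitary_spectralEmbedding, ← map_smul, ← MemLp.toLp_const_smul]
    congr 1
    refine MemLp.toLp_congr _ _ (ae_of_all _ fun w => ?_)
    by_cases h : w = z
    · simp [h]
    · simp [h]
  have hφu : ⟪φ, u⟫_ℂ = m := by
    have h1 := hinner φ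
    -- An almost everywhere identity holds at z itself because {z} has positive mass.
    have h2 : spectralRep W φ φ z = 1 := by
      by_contra hne
      refine hatom (measure_mono_null ?_ (ae_iff.1 (spectralRep_self W φ)))
      simpa using hne
    rw [h2, mul_one] at h1
    rw [← inner_conj_symm, h1, Complex.conj_ofReal]
  have hUu : (U : H →L[ℂ] H) u = (z : ℂ) • u + ((1 - (l : ℂ)) * m) • (U : H →L[ℂ] H) φ := by
    rw [hW, perturb_apply, hφu] at hWu
    rw [← hWu]
    abel
  -- Both sides solve the same inhomogeneous equation for U - z, so their difference is an
  -- eigenvector of U, hence zero.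
  have huv : u = ((1 - (l : ℂ)) * m) • poleVector hz := by
    rw [← sub_eq_zero]
    refine hcyc.eq_zero_of_eigenvector hz ?_
    rw [map_sub, map_smul, hUu, unitary_poleVector]
    module
  have h3 := hinner ψ
  rw [huv, inner_smul_left, map_mul, Complex.conj_ofReal] at h3
  refine mul_left_cancel₀ hm0 ?_
  rw [← h3]
  ring

/-- Otherwise (U_λ - z) v_z would be a nonzero multiple of Uφ = λ⁻¹ U_λ φ, which would force the
potential of the perturbed measure to be finite at z. -/
lemma inner_poleVector_of_G_perturb {U : unitary (H →L[ℂ] H)} {φ : H} (hφ : ‖φ‖ = 1)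
    {z : Circle} (hz : G U φ z < ∞) {l : Circle}
    (hl : ¬ G (perturb U φ hφ l) φ z < ∞) : (1 - (l : ℂ)) * ⟪φ, poleVector hz⟫_ℂ = 1 := by
  by_contra hne
  refine hl (G_lt_top_of_sub_eq_smul (x := poleVector hz)
    (c := (1 - (1 - (l : ℂ)) * ⟪φ, poleVector hz⟫_ℂ) * (l : ℂ)⁻¹)
    (mul_ne_zero (sub_ne_zero.2 (Ne.symm hne)) (inv_ne_zero l.coe_ne_zero)) ?_)
  rw [perturb_apply, perturb_apply_self, unitary_poleVector, smul_smul,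
    inv_mul_cancel_right₀ l.coe_ne_zero]
  module

/-- If `G` is finite almost everywhere with respect to the spectral measure of the perturbed
operator, then that measure is pure point and `ψ` is represented by the pole vectors. -/
lemma ae_spectralRep_perturb {U : unitary (H →L[ℂ] H)} {φ : H} (hφ : ‖φ‖ = 1)
    (hcyc : IsCyclic U φ) {l : Circle}
    (hG : ∀ᵐ z ∂spectralMeasure (perturb U φ hφ l) φ, G U φ z < ∞) (ψ : H) :
    ∀ᵐ z ∂spectralMeasure (perturb U φ hφ l) φ, ∃ hz : G U φ z < ∞,
      spectralRep (perturb U φ hφ l) φ ψ z =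
        starRingEnd ℂ (1 - (l : ℂ)) * ⟪poleVector hz, ψ⟫_ℂ := by
  have hnull : ∀ᵐ z ∂spectralMeasure (perturb U φ hφ l) φ,
      ¬ G (perturb U φ hφ l) φ z < ∞ := by
    rw [ae_iff]
    simpa only [not_not] using!
      measure_setOf_lintegral_inv_sq_lt_top (spectralMeasure (perturb U φ hφ l) φ)
  filter_upwards [hG, hnull] with z hz hl
  have h1 := inner_poleVector_of_G_perturb hφ hz hl
  refine ⟨hz, spectralRep_perturb_of_atom hφ hcyc hz ?_ ψ⟩
  refine spectralMeasure_singleton_ne_zero (v := poleVector hz) ?_ ?_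
  · rw [perturb_apply, unitary_poleVector, h1, one_smul, add_sub_cancel_right]
  · exact right_ne_zero_of_mul (h1.trans_ne one_ne_zero)

/-! ### Fourier coefficients of measures on the circle -/

/-- The function `w ↦ w ^ n` on the circle. -/
def circlePow (n : ℤ) : C(Circle, ℂ) :=
  ⟨fun w => (w : ℂ) ^ n, Continuous.zpow₀ (by fun_prop) n fun w => Or.inl w.coe_ne_zero⟩

/-- Trigonometric polynomials are dense in the continuous functions on the circle. -/
lemma eq_top_of_circlePow_mem {S : Submodule ℂ C(Circle, ℂ)} (hS : IsClosed (S : Set C(Circle, ℂ)))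
    (hmem : ∀ n, circlePow n ∈ S) : S = ⊤ := by
  have : Fact (0 < 2 * Real.pi) := ⟨Real.two_pi_pos⟩
  let e : C(Circle, AddCircle (2 * Real.pi)) :=
    ⟨AddCircle.homeomorphCircle'.symm, AddCircle.homeomorphCircle'.symm.continuous⟩
  let c := ContinuousMap.compRightAlgHom ℂ ℂ e
  have hc : Continuous c := ContinuousMap.compRightAlgHom_continuous ℂ ℂ e
  have hfour : ∀ n : ℤ, c (fourier n) = circlePow n := by
    intro n
    ext w
    obtain ⟨t, rfl⟩ := Circle.exp_surjective w
    have he : e (Circle.exp t) = (t : AddCircle (2 * Real.pi)) := by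
      change AddCircle.homeomorphCircle'.symm (Circle.exp t) = _
      rw [Homeomorph.symm_apply_eq, AddCircle.homeomorphCircle'_apply_mk]
    change fourier n (e (Circle.exp t)) = (Circle.exp t : ℂ) ^ n
    rw [he, fourier_coe_apply, Circle.coe_exp, ← Complex.exp_int_mul]
    congr 1
    have : (Real.pi : ℂ) ≠ 0 := by exact_mod_cast Real.pi_ne_zero
    push_cast
    field_simp
  have hle : (Submodule.span ℂ (Set.range (fourier (T := 2 * Real.pi)))).topologicalClosure ≤
      S.comap c.toLinearMap := by
    refine Submodule.topologicalClosure_minimal _ ?_ (hS.preimage hc)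
    rw [Submodule.span_le]
    rintro _ ⟨n, rfl⟩
    change c (fourier n) ∈ S
    rw [hfour]
    exact hmem n
  rw [span_fourier_closure_eq_top, top_le_iff] at hle
  rw [eq_top_iff]
  intro f _
  let e' : C(AddCircle (2 * Real.pi), Circle) :=
    ⟨AddCircle.homeomorphCircle', AddCircle.homeomorphCircle'.continuous⟩
  have h1 : f.comp e' ∈ S.comap c.toLinearMap := by rw [hle]; trivial
  have h2 : c (f.comp e') = f := by
    ext w
    change f (AddCircle.homeomorphCircle' (AddCircle.homeomorphCircle'.symm w)) = f w
    rw [Homeomorph.apply_symm_apply]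
  rw [← h2]
  exact h1

lemma _root_.ContinuousMap.integrable_of_compactSpace {X : Type*} [TopologicalSpace X]
    [CompactSpace X] [MeasurableSpace X] [BorelSpace X] (μ : Measure X) [IsFiniteMeasure μ]
    (f : C(X, ℂ)) : Integrable f μ :=
  f.continuous.integrable_of_hasCompactSupport (HasCompactSupport.of_compactSpace _)

lemma norm_integral_le_norm_continuousMap {X : Type*} [TopologicalSpace X] [CompactSpace X]
    [MeasurableSpace X] (μ : Measure X) [IsProbabilityMeasure μ] (f : C(X, ℂ)) :
    ‖∫ w, f w ∂μ‖ ≤ ‖f‖ := by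
  simpa using norm_integral_le_of_norm_le_const (μ := μ) (ae_of_all _ f.norm_coe_le_norm)

/-- Integration of continuous functions on the circle against a probability measure. -/
def circleIntegralCLM (μ : Measure Circle) [IsProbabilityMeasure μ] : C(Circle, ℂ) →L[ℂ] ℂ :=
  LinearMap.mkContinuous
    { toFun := fun f => ∫ w, f w ∂μ
      map_add' := fun f g => integral_add (f.integrable_of_compactSpace μ)
        (g.integrable_of_compactSpace μ)
      map_smul' := fun c f => integral_const_mul c f } 1
    fun f => by rw [one_mul]; exact norm_integral_le_norm_continuousMap μ f

/-- A probability measure on the circle is determined by its Fourier coefficients. -/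
lemma ext_of_integral_circlePow {μ ν : Measure Circle} [IsProbabilityMeasure μ]
    [IsProbabilityMeasure ν]
    (h : ∀ n : ℤ, ∫ w : Circle, (w : ℂ) ^ n ∂μ = ∫ w : Circle, (w : ℂ) ^ n ∂ν) : μ = ν := by
  have hS : LinearMap.ker (circleIntegralCLM μ - circleIntegralCLM ν).toLinearMap = ⊤ := by
    refine eq_top_of_circlePow_mem
      (circleIntegralCLM μ - circleIntegralCLM ν).isClosed_ker fun n => ?_
    rw [LinearMap.mem_ker]
    exact sub_eq_zero.2 (h n)
  refine ext_of_forall_integral_eq_of_IsFiniteMeasure fun f => ?_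
  let g : C(Circle, ℂ) := ⟨fun w => ((f w : ℝ) : ℂ), by fun_prop⟩
  have hg : g ∈ LinearMap.ker (circleIntegralCLM μ - circleIntegralCLM ν).toLinearMap := by
    rw [hS]; trivial
  have h2 : ∫ w, ((f w : ℝ) : ℂ) ∂μ = ∫ w, ((f w : ℝ) : ℂ) ∂ν := sub_eq_zero.1 hg
  refine Complex.ofReal_injective ?_
  rw [← integral_complex_ofReal, ← integral_complex_ofReal]
  exact h2

/-- A family of probability measures on the circle with continuous Fourier coefficients has
continuous integrals of continuous functions. -/
lemma continuous_integral_of_continuous_circlePow {X : Type*} [TopologicalSpace X]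
    {κ : X → Measure Circle} [∀ x, IsProbabilityMeasure (κ x)]
    (h : ∀ n : ℤ, Continuous fun x => ∫ w : Circle, (w : ℂ) ^ n ∂κ x) (f : C(Circle, ℂ)) :
    Continuous fun x => ∫ w, f w ∂κ x := by
  let S : Submodule ℂ C(Circle, ℂ) :=
    { carrier := {f | Continuous fun x => circleIntegralCLM (κ x) f}
      add_mem' := fun {f g} hf hg => by
        simp only [Set.mem_ofPred_eq, map_add] at *
        exact hf.add hg
      zero_mem' := by simpa using continuous_const
      smul_mem' := fun c f hf => by
        simp only [Set.mem_ofPred_eq, map_smul] at *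
        exact hf.const_smul c }
  have hS : IsClosed (S : Set C(Circle, ℂ)) := by
    refine isClosed_of_closure_subset fun f hf => ?_
    -- All the measures have mass one, so a sup-norm approximation of f is uniform in x after
    -- integration.
    refine continuous_of_uniform_approx_of_continuous fun u hu => ?_
    obtain ⟨ε, hε, hεu⟩ := Metric.mem_uniformity_dist.1 hu
    obtain ⟨g, hg, hfg⟩ := Metric.mem_closure_iff.1 hf ε hε
    refine ⟨fun x => circleIntegralCLM (κ x) g, hg, fun x => hεu ?_⟩
    rw [dist_eq_norm, ← map_sub]
    refine (norm_integral_le_norm_continuousMap _ _).trans_lt ?_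
    rwa [← dist_eq_norm]
  have : f ∈ S := by rw [eq_top_of_circlePow_mem hS h]; trivial
  exact this

/-- It suffices to test closed sets, whose indicators are limits of continuous functions with
integrals continuous in x. -/
lemma measurable_of_continuous_circlePow {X : Type*} [TopologicalSpace X] [MeasurableSpace X]
    [BorelSpace X] {κ : X → Measure Circle} [∀ x, IsProbabilityMeasure (κ x)]
    (h : ∀ n : ℤ, Continuous fun x => ∫ w : Circle, (w : ℂ) ^ n ∂κ x) : Measurable κ := by
  refine Measurable.measure_of_isPiSystem_of_isProbabilityMeasure
    (borel_eq_generateFrom_isClosed (α := Circle)) isPiSystem_isClosed fun F hF => ?_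
  refine measurable_of_tendsto_metrizable
    (f := fun n x => ∫⁻ w, (IsClosed.apprSeq hF n w : ℝ≥0∞) ∂κ x) (fun n => ?_)
    (tendsto_pi_nhds.2 fun x => HasOuterApproxClosed.tendsto_lintegral_apprSeq hF (κ x))
  let g : C(Circle, ℂ) := ⟨fun w => ((IsClosed.apprSeq hF n w : ℝ) : ℂ), by fun_prop⟩
  have hg : ∀ x, ∫⁻ w, (IsClosed.apprSeq hF n w : ℝ≥0∞) ∂κ x =
      ENNReal.ofReal (∫ w, g w ∂κ x).re := by
    intro x
    have h1 : ∫ w, g w ∂κ x = ((∫ w, (IsClosed.apprSeq hF n w : ℝ) ∂κ x : ℝ) : ℂ) :=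
      integral_ofReal
    rw [h1, Complex.ofReal_re, ← BoundedContinuousFunction.toReal_lintegral_coe_eq_integral,
      ENNReal.ofReal_toReal]
    exact (BoundedContinuousFunction.lintegral_lt_top_of_nnreal _ _).ne
  simp_rw [hg]
  exact (Complex.continuous_re.comp
    (continuous_integral_of_continuous_circlePow h g)).measurable.ennreal_ofReal

/-! ### Spectral averaging -/

/-- Normalized Lebesgue measure on `(0, 2π]`. -/
def angleMeasure : Measure ℝ :=
  (ENNReal.ofReal (2 * Real.pi))⁻¹ • volume.restrict (Set.Ioc 0 (2 * Real.pi))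

instance : IsProbabilityMeasure angleMeasure := by
  refine ⟨?_⟩
  rw [angleMeasure, Measure.smul_apply, Measure.restrict_apply_univ, Real.volume_Ioc, sub_zero,
    smul_eq_mul, ENNReal.inv_mul_cancel]
  · simpa using Real.pi_pos
  · exact ENNReal.ofReal_ne_top

lemma integral_angleMeasure {E : Type*} [NormedAddCommGroup E] [NormedSpace ℝ E] (f : ℝ → E) :
    ∫ t, f t ∂angleMeasure = (2 * Real.pi)⁻¹ • ∫ t in (0 : ℝ)..(2 * Real.pi), f t := by
  rw [angleMeasure, integral_smul_measure, intervalIntegral.integral_of_le Real.two_pi_pos.le,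
    ENNReal.toReal_inv, ENNReal.toReal_ofReal Real.two_pi_pos.le]

lemma integral_angleMeasure_of_differentiable {f : ℂ → ℂ} (hf : Differentiable ℂ f) :
    ∫ t : ℝ, f (Circle.exp t : ℂ) ∂angleMeasure = f 0 := by
  have h : Real.circleAverage f 0 1 = f 0 := hf.diffContOnCl.circleAverage
  rw [integral_angleMeasure, ← h, Real.circleAverage_def]
  simp [circleMap, Circle.coe_exp]

lemma inner_perturb_pow (U : unitary (H →L[ℂ] H)) {φ : H} (hφ : ‖φ‖ = 1) (l : Circle) (n : ℕ) :
    ⟪φ, ((perturb U φ hφ l ^ (n : ℤ) : unitary (H →L[ℂ] H)) : H →L[ℂ] H) φ⟫_ℂ =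
      ⟪φ, (((U : H →L[ℂ] H) * (1 - proj φ) + (l : ℂ) • ((U : H →L[ℂ] H) * proj φ)) ^ n) φ⟫_ℂ := by
  rw [zpow_natCast, SubmonoidClass.coe_pow, coe_perturb, mul_add, mul_smul_comm]

lemma inner_zpow_neg (U : unitary (H →L[ℂ] H)) (φ : H) (n : ℤ) :
    ⟪φ, ((U ^ (-n) : unitary (H →L[ℂ] H)) : H →L[ℂ] H) φ⟫_ℂ =
      starRingEnd ℂ ⟪φ, ((U ^ n : unitary (H →L[ℂ] H)) : H →L[ℂ] H) φ⟫_ℂ := by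
  rw [inner_conj_symm, zpow_neg, ← ContinuousLinearMap.adjoint_inner_right,
    ← ContinuousLinearMap.star_eq_adjoint]
  rfl

/-- For n ≥ 0 the matrix element is a polynomial in λ, so its mean is its value at λ = 0. There the
operator U(1 - P) kills φ, so only n = 0 contributes, just as for λ^n. Negative n follow by
conjugation. -/
lemma integral_inner_perturb_zpow (U : unitary (H →L[ℂ] H)) {φ : H} (hφ : ‖φ‖ = 1) (n : ℤ) :
    ∫ t : ℝ, ⟪φ, ((perturb U φ hφ (Circle.exp t) ^ n : unitary (H →L[ℂ] H)) : H →L[ℂ] H) φ⟫_ℂ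
      ∂angleMeasure = ∫ t : ℝ, (Circle.exp t : ℂ) ^ n ∂angleMeasure := by
  have hnat : ∀ k : ℕ, ∫ t : ℝ, ⟪φ, ((perturb U φ hφ (Circle.exp t) ^ (k : ℤ) :
      unitary (H →L[ℂ] H)) : H →L[ℂ] H) φ⟫_ℂ ∂angleMeasure =
      ∫ t : ℝ, (Circle.exp t : ℂ) ^ (k : ℤ) ∂angleMeasure := by
    intro k
    simp_rw [inner_perturb_pow, zpow_natCast]
    have hd : Differentiable ℂ fun l : ℂ => ⟪φ, (((U : H →L[ℂ] H) * (1 - proj φ) +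
        l • ((U : H →L[ℂ] H) * proj φ)) ^ k) φ⟫_ℂ := by
      have h1 : Differentiable ℂ fun l : ℂ => ((U : H →L[ℂ] H) * (1 - proj φ) +
        l • ((U : H →L[ℂ] H) * proj φ)) ^ k := by fun_prop
      exact ((innerSL ℂ φ).comp (ContinuousLinearMap.apply ℂ H φ)).differentiable.comp h1
    rw [integral_angleMeasure_of_differentiable hd,
      integral_angleMeasure_of_differentiable (f := fun l => l ^ k) (by fun_prop)]
    rcases k with _ | k
    · simp [inner_self_eq_norm_sq_to_K, hφ]
    · have h0 : ((U : H →L[ℂ] H) * (1 - proj φ)) φ = 0 := by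
        simp [proj_apply, inner_self_eq_norm_sq_to_K, hφ]
      rw [zero_smul, add_zero, pow_succ, mul_apply_eq_comp, h0, map_zero, inner_zero_right,
        zero_pow k.succ_ne_zero]
  rcases Int.eq_nat_or_neg n with ⟨k, rfl | rfl⟩
  · exact hnat k
  · simp_rw [inner_zpow_neg]
    rw [integral_conj, hnat, ← integral_conj]
    refine integral_congr_ae (ae_of_all _ fun t => ?_)
    simp only [zpow_neg, map_zpow₀, ← Circle.coe_inv_eq_conj, Circle.coe_inv, inv_zpow]

lemma continuous_perturb (U : unitary (H →L[ℂ] H)) {φ : H} (hφ : ‖φ‖ = 1) :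
    Continuous (perturb U φ hφ) := by
  refine Continuous.subtype_mk ?_ _
  exact continuous_const.mul (by fun_prop)

lemma continuous_inner_perturb_zpow (U : unitary (H →L[ℂ] H)) {φ : H} (hφ : ‖φ‖ = 1) (x : H)
    (n : ℤ) : Continuous fun l : Circle =>
      ⟪φ, ((perturb U φ hφ l ^ n : unitary (H →L[ℂ] H)) : H →L[ℂ] H) x⟫_ℂ := by
  have h1 : Continuous fun l : Circle =>
      ((perturb U φ hφ l ^ n : unitary (H →L[ℂ] H)) : H →L[ℂ] H) :=
    continuous_subtype_val.comp ((continuous_perturb U hφ).zpow n)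
  exact continuous_const.inner (h1.clm_apply continuous_const)

/-- The family of spectral measures of `U_λ`, `λ = e^{it}`, as a kernel. -/
def perturbKernel (U : unitary (H →L[ℂ] H)) {φ : H} (hφ : ‖φ‖ = 1) :
    ProbabilityTheory.Kernel ℝ Circle where
  toFun t := spectralMeasure (perturb U φ hφ (Circle.exp t)) φ
  measurable' := by
    have : ∀ t : ℝ, IsProbabilityMeasure (spectralMeasure (perturb U φ hφ (Circle.exp t)) φ) :=
      fun t => isProbabilityMeasure_spectralMeasure _ hφ
    refine measurable_of_continuous_circlePow fun n => ?_
    simp_rw [integral_zpow_spectralMeasure]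
    exact (continuous_inner_perturb_zpow U hφ φ n).comp Circle.exp.continuous

lemma perturbKernel_apply (U : unitary (H →L[ℂ] H)) {φ : H} (hφ : ‖φ‖ = 1) (t : ℝ) :
    perturbKernel U hφ t = spectralMeasure (perturb U φ hφ (Circle.exp t)) φ := rfl

instance (U : unitary (H →L[ℂ] H)) {φ : H} (hφ : ‖φ‖ = 1) :
    ProbabilityTheory.IsMarkovKernel (perturbKernel U hφ) :=
  ⟨fun _ => isProbabilityMeasure_spectralMeasure _ hφ⟩

/-- **Spectral averaging**: the average of the spectral measures of `U_λ` over `|λ| = 1` is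
normalized Lebesgue measure on the circle. -/
theorem bind_perturbKernel (U : unitary (H →L[ℂ] H)) {φ : H} (hφ : ‖φ‖ = 1) :
    angleMeasure.bind (perturbKernel U hφ) = angleMeasure.map Circle.exp := by
  have hexp : Measurable Circle.exp := Circle.exp.continuous.measurable
  have : IsProbabilityMeasure (angleMeasure.map Circle.exp) :=
    Measure.isProbabilityMeasure_map hexp.aemeasurable
  refine ext_of_integral_circlePow fun n => ?_
  have hcomp : ∫ w : Circle, (w : ℂ) ^ n ∂angleMeasure.bind (perturbKernel U hφ) =
      ∫ t, ∫ w : Circle, (w : ℂ) ^ n ∂perturbKernel U hφ t ∂angleMeasure :=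
    ProbabilityTheory.Kernel.integral_comp (a := ())
      (κ := ProbabilityTheory.Kernel.const Unit angleMeasure) (η := perturbKernel U hφ)
      ((circlePow n).integrable_of_compactSpace _)
  have hmap : ∫ w : Circle, (w : ℂ) ^ n ∂angleMeasure.map Circle.exp =
      ∫ t, (Circle.exp t : ℂ) ^ n ∂angleMeasure :=
    integral_map hexp.aemeasurable (circlePow n).continuous.aestronglyMeasurable
  rw [hcomp, hmap]
  simp_rw [perturbKernel_apply, integral_zpow_spectralMeasure]
  exact integral_inner_perturb_zpow U hφ n

/-- Spectral averaging for integrals of nonnegative functions. -/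
lemma lintegral_lintegral_perturb (U : unitary (H →L[ℂ] H)) {φ : H} (hφ : ‖φ‖ = 1)
    {f : Circle → ℝ≥0∞} (hf : Measurable f) :
    ∫⁻ t, ∫⁻ z, f z ∂spectralMeasure (perturb U φ hφ (Circle.exp t)) φ ∂angleMeasure =
      ∫⁻ t, f (Circle.exp t) ∂angleMeasure := by
  rw [← lintegral_map hf Circle.exp.continuous.measurable, ← bind_perturbKernel U hφ,
    Measure.lintegral_bind (perturbKernel U hφ).measurable.aemeasurable hf.aemeasurable]
  rfl

lemma intervalIntegrable_iff_integrable_angleMeasure {f : ℝ → ℝ} :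
    IntervalIntegrable f volume 0 (2 * Real.pi) ↔ Integrable f angleMeasure := by
  rw [intervalIntegrable_iff_integrableOn_Ioc_of_le Real.two_pi_pos.le, angleMeasure,
    integrable_smul_measure (ENNReal.inv_ne_zero.2 ENNReal.ofReal_ne_top)
      (ENNReal.inv_ne_top.2 (ENNReal.ofReal_pos.2 Real.two_pi_pos).ne')]
  rfl

lemma ae_angleMeasure_of_ae {q : ℝ → Prop} (h : ∀ᵐ t : ℝ, q t) : ∀ᵐ t ∂angleMeasure, q t :=
  Measure.ae_smul_measure (ae_restrict_of_ae h) _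

/-! ### Measurability of the radial limit -/

lemma continuousOn_carath (U : unitary (H →L[ℂ] H)) (φ ψ : H) :
    ContinuousOn (carath U φ ψ) (Metric.ball 0 1) := by
  intro z hz
  refine ContinuousAt.continuousWithinAt ?_
  have h1 : ContinuousAt (fun z : ℂ => Ring.inverse ((U : H →L[ℂ] H) - z • 1)) z := by
    obtain ⟨u, hu⟩ := isUnit_sub_smul_one U (mem_ball_zero_iff.1 hz)
    have h2 := NormedRing.inverse_continuousAt u
    rw [hu] at h2
    exact ContinuousAt.comp (g := Ring.inverse) (f := fun z : ℂ => (U : H →L[ℂ] H) - z • 1) h2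
      (by fun_prop)
  have h3 : ContinuousAt (fun z : ℂ => ((U : H →L[ℂ] H) + z • 1) *
      Ring.inverse ((U : H →L[ℂ] H) - z • 1)) z := ContinuousAt.mul (by fun_prop) h1
  exact (innerSL ℂ φ).continuous.continuousAt.comp (h3.clm_apply continuousAt_const)

/-- A Borel version of the radial limit of `|⟨φ, (U + ·) (U - ·)⁻¹ ψ⟩|`. -/
def radialLimsup (U : unitary (H →L[ℂ] H)) (φ ψ : H) (z : Circle) : ℝ≥0∞ :=
  limsup (fun n : ℕ => ‖carath U φ ψ (((1 - 1 / ((n : ℝ) + 1) : ℝ) : ℂ) * (z : ℂ))‖ₑ) atTop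

lemma measurable_radialLimsup (U : unitary (H →L[ℂ] H)) (φ ψ : H) :
    Measurable (radialLimsup U φ ψ) := by
  refine Measurable.limsup fun n => Continuous.measurable (Continuous.enorm ?_)
  refine (continuousOn_carath U φ ψ).comp_continuous (by fun_prop) fun z => ?_
  have h : (0 : ℝ) < 1 / ((n : ℝ) + 1) := by positivity
  have h' : 1 / ((n : ℝ) + 1) ≤ 1 := by
    rw [div_le_one (by positivity)]; linarith [(Nat.cast_nonneg n : (0 : ℝ) ≤ n)]
  rw [mem_ball_zero_iff, norm_mul, Circle.norm_coe, mul_one, Complex.norm_real, Real.norm_eq_abs,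
    abs_of_nonneg (by linarith)]
  linarith

lemma radialLimsup_eq {U : unitary (H →L[ℂ] H)} {φ ψ : H} {z : Circle} {L : ℂ}
    (hL : Tendsto (fun r : ℝ => carath U φ ψ ((r : ℂ) * (z : ℂ))) (𝓝[<] (1 : ℝ)) (𝓝 L)) :
    radialLimsup U φ ψ z = ‖L‖ₑ := by
  have hr : Tendsto (fun n : ℕ => (1 - 1 / ((n : ℝ) + 1) : ℝ)) atTop (𝓝[<] 1) := by
    refine tendsto_nhdsWithin_iff.2 ⟨?_, Eventually.of_forall fun n => ?_⟩
    · simpa using (tendsto_one_div_add_atTop_nhds_zero_nat (𝕜 := ℝ)).const_sub 1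
    · have h : (0 : ℝ) < 1 / ((n : ℝ) + 1) := by positivity
      simpa using h
  exact ((hL.comp hr).enorm).limsup_eq

lemma radialLimsup_eq_poleVector {U : unitary (H →L[ℂ] H)} {φ ψ : H} (hψφ : ⟪φ, ψ⟫_ℂ = 0)
    {z : Circle} (hz : G U φ z < ∞) :
    radialLimsup U φ ψ z = 2 * ‖⟪poleVector hz, ψ⟫_ℂ‖ₑ := by
  rw [radialLimsup_eq (tendsto_carath hψφ hz), enorm_mul, enorm_neg]
  congr 1
  rw [← ofReal_norm]
  simp

lemma boundaryPow_eq {U : unitary (H →L[ℂ] H)} {φ ψ : H} (hψφ : ⟪φ, ψ⟫_ℂ = 0) {p : ℝ}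
    (hp : 0 < p) {t : ℝ} (ht : G U φ (Circle.exp t) < ∞) :
    boundaryPow U φ ψ p t = (radialLimsup U φ ψ (Circle.exp t) ^ p).toReal := by
  have h := tendsto_carath hψφ ht
  rw [radialLimsup_eq h, ← ENNReal.toReal_rpow, toReal_enorm]
  exact Tendsto.limUnder_eq (h.norm.rpow_const (Or.inr hp.le))

/-! ### Norm bounds, interpolation and the singularity at λ = 1 -/

lemma lintegral_enorm_spectralRep_sq_le (U : unitary (H →L[ℂ] H)) (φ ψ : H) (hψ : ‖ψ‖ ≤ 1) :
    ∫⁻ z, ‖spectralRep U φ ψ z‖ₑ ^ (2 : ℝ) ∂spectralMeasure U φ ≤ 1 := by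
  have h := (norm_spectralRep_le U φ ψ).trans hψ
  rw [Lp.norm_def, ← ENNReal.toReal_one,
    ENNReal.toReal_le_toReal (Lp.eLpNorm_ne_top _) ENNReal.one_ne_top,
    eLpNorm_eq_lintegral_rpow_enorm_toReal (by simp) (by simp), ENNReal.toReal_ofNat] at h
  rwa [one_div, ENNReal.rpow_inv_le_iff zero_lt_two, ENNReal.one_rpow] at h

lemma norm_inner_zpow_le (W : unitary (H →L[ℂ] H)) {φ ψ : H} (hφ : ‖φ‖ = 1) (hψ : ‖ψ‖ ≤ 1)
    (n : ℤ) : ‖⟪φ, ((W ^ n : unitary (H →L[ℂ] H)) : H →L[ℂ] H) ψ⟫_ℂ‖ ≤ 1 := by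
  refine (norm_inner_le_norm _ _).trans ?_
  have h : ‖((W ^ n : unitary (H →L[ℂ] H)) : H →L[ℂ] H) ψ‖ = ‖ψ‖ :=
    ContinuousLinearMap.norm_map_of_mem_unitary (W ^ n).2 ψ
  rw [hφ, h, one_mul]
  exact hψ

lemma enorm_inner_zpow_le (W : unitary (H →L[ℂ] H)) (φ ψ : H) (n : ℤ) :
    ‖⟪φ, ((W ^ n : unitary (H →L[ℂ] H)) : H →L[ℂ] H) ψ⟫_ℂ‖ₑ ≤
      ∫⁻ z, ‖spectralRep W φ ψ z‖ₑ ∂spectralMeasure W φ := by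
  rw [inner_zpow_eq_integral]
  refine (enorm_integral_le_lintegral_enorm _).trans (lintegral_mono fun z => ?_)
  rw [enorm_mul, ← ofReal_norm, norm_zpow, Circle.norm_coe, one_zpow, ENNReal.ofReal_one, one_mul]

/-- Interpolation of the `L¹` norm between `p < 1` and `2`. -/
lemma lintegral_le_rpow_of_lintegral_sq_le_one {X : Type*} [MeasurableSpace X] {μ : Measure X}
    {f : X → ℝ≥0∞} (hf : AEMeasurable f μ) (h2 : ∫⁻ x, f x ^ (2 : ℝ) ∂μ ≤ 1) {p : ℝ} (hp0 : 0 < p)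
    (hp1 : p < 1) : ∫⁻ x, f x ∂μ ≤ (∫⁻ x, f x ^ p ∂μ) ^ (1 / (2 - p)) := by
  have hpos : 0 < 2 - p := by linarith
  -- Hölder with weights a = 1/(2-p) and b = (1-p)/(2-p), the solution of a + b = 1 and pa + 2b = 1.
  have h1 := ENNReal.lintegral_mul_norm_pow_le (hf.pow_const p) (hf.pow_const (2 : ℝ))
    (p := 1 / (2 - p)) (q := (1 - p) / (2 - p)) (by positivity)
    (div_nonneg (by linarith) hpos.le) (by field_simp; ring)
  calc ∫⁻ x, f x ∂μ = ∫⁻ x, (f x ^ p) ^ (1 / (2 - p)) * (f x ^ (2 : ℝ)) ^ ((1 - p) / (2 - p)) ∂μ := by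
        refine lintegral_congr fun x => ?_
        rw [← ENNReal.rpow_mul, ← ENNReal.rpow_mul, ← ENNReal.rpow_add_of_nonneg _ _ (by positivity)
          (mul_nonneg zero_le_two (div_nonneg (by linarith) hpos.le))]
        have : p * (1 / (2 - p)) + 2 * ((1 - p) / (2 - p)) = 1 := by field_simp; ring
        rw [this, ENNReal.rpow_one]
    _ ≤ _ := h1
    _ ≤ (∫⁻ x, f x ^ p ∂μ) ^ (1 / (2 - p)) * 1 := by
        gcongr
        exact ENNReal.rpow_le_one h2 (div_nonneg (by linarith) hpos.le)
    _ = _ := mul_one _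

lemma lintegral_rpow_le_rpow_lintegral {X : Type*} [MeasurableSpace X] {μ : Measure X}
    [IsProbabilityMeasure μ] {f : X → ℝ≥0∞} (hf : AEMeasurable f μ) {a : ℝ} (ha0 : 0 ≤ a)
    (ha1 : a ≤ 1) : ∫⁻ x, f x ^ a ∂μ ≤ (∫⁻ x, f x ∂μ) ^ a := by
  have h := ENNReal.lintegral_mul_norm_pow_le hf (aemeasurable_const (b := (1 : ℝ≥0∞)) (μ := μ))
    ha0 (sub_nonneg.2 ha1) (by ring)
  simpa using h

/-- |1 - e^{it}| = 2 sin(t/2) vanishes only linearly at the two ends of [0, 2π], so its power -p is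
integrable for p < 1. -/
lemma lintegral_angle_singularity_lt_top {p : ℝ} (hp0 : 0 < p) (hp1 : p < 1) :
    ∫⁻ t, (2 / ‖1 - (Circle.exp t : ℂ)‖ₑ) ^ p ∂angleMeasure < ∞ := by
  have hint : IntervalIntegrable (fun t : ℝ => Real.pi ^ p * (t ^ (-p) + (2 * Real.pi - t) ^ (-p)))
      volume 0 (2 * Real.pi) := by
    have h1 : IntervalIntegrable (fun t : ℝ => t ^ (-p)) volume 0 (2 * Real.pi) :=
      intervalIntegral.intervalIntegrable_rpow' (by linarith)
    have h2 := (h1.comp_sub_left (2 * Real.pi)).symm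
    simp only [sub_zero, sub_self] at h2
    exact (h1.add h2).const_mul _
  rw [intervalIntegrable_iff_integrable_angleMeasure] at hint
  refine lt_of_le_of_lt (lintegral_mono_ae ?_) hint.lintegral_lt_top
  have hmem : ∀ᵐ t ∂angleMeasure, t ∈ Set.Ioo 0 (2 * Real.pi) := by
    refine Measure.ae_smul_measure ?_ _
    filter_upwards [ae_restrict_mem measurableSet_Ioc,
      ae_restrict_of_ae (Measure.ae_ne volume (2 * Real.pi))] with t ht ht'
    exact ⟨ht.1, lt_of_le_of_ne ht.2 ht'⟩
  filter_upwards [hmem] with t ht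
  have hs : 0 < Real.sin (t / 2) :=
    Real.sin_pos_of_pos_of_lt_pi (by linarith [ht.1]) (by linarith [ht.2])
  have hnorm : ‖1 - (Circle.exp t : ℂ)‖ = 2 * Real.sin (t / 2) := by
    rw [norm_sub_rev, Circle.coe_exp, mul_comm, Complex.norm_exp_I_mul_ofReal_sub_one,
      Real.norm_of_nonneg (by positivity)]
  have hval : (2 / ‖1 - (Circle.exp t : ℂ)‖ₑ) ^ p = ENNReal.ofReal ((Real.sin (t / 2))⁻¹ ^ p) := by
    rw [← ofReal_norm, hnorm, ← ENNReal.ofReal_ofNat 2, ← ENNReal.ofReal_div_of_pos (by positivity),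
      ENNReal.ofReal_rpow_of_pos (by positivity)]
    congr 2
    rw [div_mul_eq_div_div, div_self two_ne_zero, one_div]
  rw [hval]
  refine ENNReal.ofReal_le_ofReal ?_
  have hpi := Real.pi_pos
  have ha : 0 ≤ t ^ (-p) := Real.rpow_nonneg ht.1.le _
  have hb : 0 ≤ (2 * Real.pi - t) ^ (-p) := Real.rpow_nonneg (by linarith [ht.2]) _
  -- Here s is the distance from t to the nearer endpoint, which keeps s/2 in the range of Jordan's
  -- inequality.
  have key : ∀ s : ℝ, 0 < s → s ≤ Real.pi → Real.sin (t / 2) = Real.sin (s / 2) →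
      (Real.sin (t / 2))⁻¹ ^ p ≤ Real.pi ^ p * s ^ (-p) := by
    intro s hs0 hs1 hst
    have h1 : 2 / Real.pi * (s / 2) ≤ Real.sin (s / 2) :=
      Real.mul_le_sin (by positivity) (by linarith)
    have h2 : (Real.sin (t / 2))⁻¹ ≤ Real.pi / s := by
      rw [hst, inv_le_comm₀ (hst ▸ hs) (by positivity), inv_div]
      calc s / Real.pi = 2 / Real.pi * (s / 2) := by field_simp
        _ ≤ _ := h1
    calc _ ≤ (Real.pi / s) ^ p := Real.rpow_le_rpow (by positivity) h2 hp0.le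
      _ = _ := by rw [Real.div_rpow hpi.le hs0.le, Real.rpow_neg hs0.le]; rfl
  rcases le_total t Real.pi with h | h
  · refine (key t ht.1 h rfl).trans ?_
    have : 0 ≤ Real.pi ^ p := by positivity
    nlinarith
  · refine (key (2 * Real.pi - t) (by linarith [ht.2]) (by linarith) ?_).trans ?_
    · rw [show (2 * Real.pi - t) / 2 = Real.pi - t / 2 by ring, Real.sin_pi_sub]
    · have : 0 ≤ Real.pi ^ p := by positivity
      nlinarith

/-! ### Estimates for almost every perturbation -/

/-- Spectral averaging applied to the indicator of the Lebesgue-null set {G = ∞}. -/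
lemma ae_ae_G_lt_top {U : unitary (H →L[ℂ] H)} {φ : H} (hφ : ‖φ‖ = 1)
    (hG : ∀ᵐ t : ℝ, G U φ (Circle.exp t) < ∞) :
    ∀ᵐ t ∂angleMeasure, ∀ᵐ z ∂spectralMeasure (perturb U φ hφ (Circle.exp t)) φ, G U φ z < ∞ := by
  have hmeas : MeasurableSet {z | ¬ G U φ z < ∞} :=
    (measurableSet_lt (measurable_G U φ) measurable_const).compl
  have h := lintegral_lintegral_perturb U hφ (measurable_one.indicator hmeas)
  have h0 : ∫⁻ t, ({z | ¬ G U φ z < ∞} : Set Circle).indicator 1 (Circle.exp t) ∂angleMeasure =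
      (0 : ℝ≥0∞) := by
    refine lintegral_eq_zero_of_ae_eq_zero ?_
    filter_upwards [ae_angleMeasure_of_ae hG] with t ht
    exact Set.indicator_of_notMem (not_not_intro ht) _
  simp_rw [h0, lintegral_indicator_one hmeas] at h
  replace h := (lintegral_eq_zero_iff ((perturbKernel U hφ).measurable_coe hmeas)).1 h
  filter_upwards [h] with t ht
  exact ae_iff.2 ht

/-- For almost every `λ = e^{it}`, the representation of `ψ` with respect to `U_λ` has modulus
`|1 - λ| / 2` times the radial limit. -/
lemma ae_two_mul_enorm_spectralRep_perturb {U : unitary (H →L[ℂ] H)} {φ ψ : H} (hφ : ‖φ‖ = 1)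
    (hcyc : IsCyclic U φ) (hψφ : ⟪φ, ψ⟫_ℂ = 0)
    (hG : ∀ᵐ t : ℝ, G U φ (Circle.exp t) < ∞) :
    ∀ᵐ t ∂angleMeasure, ∀ᵐ z ∂spectralMeasure (perturb U φ hφ (Circle.exp t)) φ,
      2 * ‖spectralRep (perturb U φ hφ (Circle.exp t)) φ ψ z‖ₑ =
        ‖1 - (Circle.exp t : ℂ)‖ₑ * radialLimsup U φ ψ z := by
  filter_upwards [ae_ae_G_lt_top hφ hG] with t ht
  filter_upwards [ae_spectralRep_perturb hφ hcyc ht ψ] with z hz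
  obtain ⟨hz, h⟩ := hz
  rw [h, radialLimsup_eq_poleVector hψφ hz, enorm_mul, ← ofReal_norm, RCLike.norm_conj,
    ofReal_norm, mul_left_comm]

lemma lintegral_radialLimsup_rpow_lt_top {U : unitary (H →L[ℂ] H)} {φ ψ : H} (hφ : ‖φ‖ = 1)
    (hcyc : IsCyclic U φ) (hψφ : ⟪φ, ψ⟫_ℂ = 0) (hψ : ‖ψ‖ ≤ 1)
    (hG : ∀ᵐ t : ℝ, G U φ (Circle.exp t) < ∞) {p : ℝ} (hp0 : 0 < p) (hp1 : p < 1) :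
    ∫⁻ t, radialLimsup U φ ψ (Circle.exp t) ^ p ∂angleMeasure < ∞ := by
  rw [← lintegral_lintegral_perturb U hφ ((measurable_radialLimsup U φ ψ).pow_const p)]
  refine lt_of_le_of_lt (lintegral_mono_ae ?_) (lintegral_angle_singularity_lt_top hp0 hp1)
  filter_upwards [ae_two_mul_enorm_spectralRep_perturb hφ hcyc hψφ hG] with t ht
  -- At λ = 1 the bound is 2/0 = ∞ and nothing is claimed.
  rcases eq_or_ne ‖1 - (Circle.exp t : ℂ)‖ₑ 0 with hne | hne
  · rw [hne, ENNReal.div_zero two_ne_zero, ENNReal.top_rpow_of_pos hp0]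
    exact le_top
  have hprob := isProbabilityMeasure_spectralMeasure (perturb U φ hφ (Circle.exp t)) hφ
  set W := perturb U φ hφ (Circle.exp t)
  have hm : AEMeasurable (fun z => ‖spectralRep W φ ψ z‖ₑ) (spectralMeasure W φ) :=
    (Lp.aestronglyMeasurable (spectralRep W φ ψ)).enorm
  have h1 : ∫⁻ z, ‖spectralRep W φ ψ z‖ₑ ^ p ∂spectralMeasure W φ ≤ 1 := by
    have h2 := lintegral_rpow_le_rpow_lintegral (hm.pow_const (2 : ℝ)) (a := p / 2) (by linarith)
      (by linarith)
    simp_rw [← ENNReal.rpow_mul] at h2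
    rw [mul_div_cancel₀ p two_ne_zero] at h2
    exact h2.trans (ENNReal.rpow_le_one (lintegral_enorm_spectralRep_sq_le W φ ψ hψ) (by linarith))
  calc ∫⁻ z, radialLimsup U φ ψ z ^ p ∂spectralMeasure W φ
      = ∫⁻ z, (2 / ‖1 - (Circle.exp t : ℂ)‖ₑ) ^ p * ‖spectralRep W φ ψ z‖ₑ ^ p
          ∂spectralMeasure W φ := by
        refine lintegral_congr_ae ?_
        filter_upwards [ht] with z hz
        rw [← ENNReal.mul_rpow_of_nonneg _ _ hp0.le, ENNReal.mul_div_right_comm.symm, hz,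
          mul_comm, ENNReal.mul_div_cancel_right hne enorm_ne_top]
    _ = (2 / ‖1 - (Circle.exp t : ℂ)‖ₑ) ^ p *
          ∫⁻ z, ‖spectralRep W φ ψ z‖ₑ ^ p ∂spectralMeasure W φ :=
        lintegral_const_mul'' _ (hm.pow_const p)
    _ ≤ _ := mul_le_of_le_one_right' h1

lemma ae_supAmplitude_le {U : unitary (H →L[ℂ] H)} {φ ψ : H} (hφ : ‖φ‖ = 1)
    (hcyc : IsCyclic U φ) (hψφ : ⟪φ, ψ⟫_ℂ = 0) (hψ : ‖ψ‖ ≤ 1)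
    (hG : ∀ᵐ t : ℝ, G U φ (Circle.exp t) < ∞) {p : ℝ} (hp0 : 0 < p) (hp1 : p < 1) :
    ∀ᵐ t ∂angleMeasure,
    ENNReal.ofReal (supAmplitude U φ ψ hφ t) ≤
      (∫⁻ z, radialLimsup U φ ψ z ^ p ∂spectralMeasure (perturb U φ hφ (Circle.exp t)) φ) ^
        (1 / (2 - p)) := by
  filter_upwards [ae_two_mul_enorm_spectralRep_perturb hφ hcyc hψφ hG] with t ht
  set W := perturb U φ hφ (Circle.exp t) with hW
  have hm : AEMeasurable (fun z => ‖spectralRep W φ ψ z‖ₑ) (spectralMeasure W φ) :=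
    (Lp.aestronglyMeasurable (spectralRep W φ ψ)).enorm
  have h1 : ENNReal.ofReal (supAmplitude U φ ψ hφ t) ≤
      ∫⁻ z, ‖spectralRep W φ ψ z‖ₑ ∂spectralMeasure W φ := by
    have hfin : ∫⁻ z, ‖spectralRep W φ ψ z‖ₑ ∂spectralMeasure W φ ≠ ∞ :=
      ((Lp.memLp (spectralRep W φ ψ)).integrable one_le_two).2.ne
    refine ENNReal.ofReal_le_of_le_toReal (ciSup_le fun n => ?_)
    rw [← toReal_enorm]
    exact ENNReal.toReal_mono hfin (enorm_inner_zpow_le W φ ψ n)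
  refine h1.trans ((lintegral_le_rpow_of_lintegral_sq_le_one hm
    (lintegral_enorm_spectralRep_sq_le W φ ψ hψ) hp0 hp1).trans ?_)
  refine ENNReal.rpow_le_rpow (lintegral_mono_ae ?_) (by
    have : 0 < 2 - p := by linarith
    positivity)
  filter_upwards [ht] with z hz
  refine ENNReal.rpow_le_rpow ?_ hp0.le
  -- This cancels the factor 2 of the radial limit and leaves |ψ_λ| ≤ R.
  have h2 : ‖1 - (Circle.exp t : ℂ)‖ₑ ≤ 2 := by
    rw [← ofReal_norm, ← ENNReal.ofReal_ofNat 2]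
    refine ENNReal.ofReal_le_ofReal ((norm_sub_le _ _).trans ?_)
    rw [norm_one, Circle.norm_coe]
    norm_num
  refine (ENNReal.mul_le_mul_iff_right two_ne_zero ENNReal.ofNat_ne_top).1 ?_
  rw [hz]
  gcongr

lemma integrable_supAmplitude {U : unitary (H →L[ℂ] H)} {φ ψ : H} (hφ : ‖φ‖ = 1)
    (hψ : ‖ψ‖ ≤ 1) : Integrable (supAmplitude U φ ψ hφ) angleMeasure := by
  have hmeas : Measurable (supAmplitude U φ ψ hφ) := by
    refine Measurable.iSup fun n => ?_
    exact (((continuous_inner_perturb_zpow U hφ ψ n).comp Circle.exp.continuous).norm).measurable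
  refine Integrable.of_bound hmeas.aestronglyMeasurable 1 (ae_of_all _ fun t => ?_)
  rw [supAmplitude, Real.norm_of_nonneg (Real.iSup_nonneg fun n => norm_nonneg _)]
  exact ciSup_le fun n => norm_inner_zpow_le _ hφ hψ n

end RankOneUnitary

end

theorem theorem4p2 {H : Type*} [NormedAddCommGroup H] [InnerProductSpace ℂ H] [CompleteSpace H]
    (U : unitary (H →L[ℂ] H)) (φ ψ : H) (hφ : ‖φ‖ = 1)
    (hcyc : RankOneUnitary.IsCyclic U φ)
    (hψφ : ⟪φ, ψ⟫_ℂ = 0) (hψ : ‖ψ‖ ≤ 1)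
    (hG : ∀ᵐ θ₀ : ℝ, RankOneUnitary.G U φ (Circle.exp θ₀) < ∞)
    (p : ℝ) (hp0 : 0 < p) (hp1 : p < 1) :
    (∀ᵐ θ : ℝ, ∃ L : ℂ, Tendsto
      (fun r : ℝ => RankOneUnitary.carath U φ ψ ((r : ℂ) * (Circle.exp θ : ℂ)))
      (𝓝[<] (1 : ℝ)) (𝓝 L)) ∧
    IntervalIntegrable (RankOneUnitary.boundaryPow U φ ψ p) volume 0 (2 * Real.pi) ∧
    (∀ η : ℝ, BddAbove (Set.range fun n : ℤ =>
      ‖⟪φ, ((RankOneUnitary.perturb U φ hφ (Circle.exp η) ^ n : unitary (H →L[ℂ] H)) :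
        H →L[ℂ] H) ψ⟫_ℂ‖)) ∧
    IntervalIntegrable (RankOneUnitary.supAmplitude U φ ψ hφ) volume 0 (2 * Real.pi) ∧
    (2 * Real.pi)⁻¹ * ∫ η in (0 : ℝ)..(2 * Real.pi), RankOneUnitary.supAmplitude U φ ψ hφ η ≤
      ((2 * Real.pi)⁻¹ *
        ∫ θ in (0 : ℝ)..(2 * Real.pi), RankOneUnitary.boundaryPow U φ ψ p θ) ^ (1 / (2 - p)) := by
  open RankOneUnitary in
  have hpos : 0 < 2 - p := by linarith
  have hfin := lintegral_radialLimsup_rpow_lt_top hφ hcyc hψφ hψ hG hp0 hp1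
  have hm := (measurable_radialLimsup U φ ψ).pow_const p
  have hme : Measurable fun t => radialLimsup U φ ψ (Circle.exp t) ^ p :=
    hm.comp Circle.exp.continuous.measurable
  have hbd : boundaryPow U φ ψ p =ᵐ[angleMeasure]
      fun t => (radialLimsup U φ ψ (Circle.exp t) ^ p).toReal := by
    filter_upwards [ae_angleMeasure_of_ae hG] with t ht using boundaryPow_eq hψφ hp0 ht
  have hsup := integrable_supAmplitude hφ hψ (U := U)
  refine ⟨?_, ?_, fun η => ⟨1, ?_⟩, intervalIntegrable_iff_integrable_angleMeasure.2 hsup, ?_⟩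
  · filter_upwards [hG] with t ht using ⟨_, tendsto_carath hψφ ht⟩
  · rw [intervalIntegrable_iff_integrable_angleMeasure]
    exact (integrable_toReal_of_lintegral_ne_top hme.aemeasurable hfin.ne).congr hbd.symm
  · rintro _ ⟨n, rfl⟩
    exact norm_inner_zpow_le _ hφ hψ n
  · have hnonneg : 0 ≤ᵐ[angleMeasure] supAmplitude U φ ψ hφ :=
      ae_of_all _ fun t => Real.iSup_nonneg fun n => norm_nonneg _
    have h1 := integral_angleMeasure (supAmplitude U φ ψ hφ)
    have h2 := integral_angleMeasure (boundaryPow U φ ψ p)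
    rw [smul_eq_mul] at h1 h2
    rw [← h1, ← h2, integral_congr_ae hbd, integral_toReal hme.aemeasurable
      (ae_lt_top hme hfin.ne), ENNReal.toReal_rpow,
      integral_eq_lintegral_of_nonneg_ae hnonneg hsup.1]
    refine ENNReal.toReal_mono (ENNReal.rpow_ne_top_of_nonneg (by positivity) hfin.ne) ?_
    refine (lintegral_mono_ae (ae_supAmplitude_le hφ hcyc hψφ hψ hG hp0 hp1)).trans ?_
    rw [← lintegral_lintegral_perturb U hφ hm]
    -- Jensen in λ: the exponent 1/(2-p) is at most 1.
    refine lintegral_rpow_le_rpow_lintegral ?_ (by positivity) ?_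
    · exact (hm.lintegral_kernel (κ := perturbKernel U hφ)).aemeasurable
    · rw [div_le_one hpos]; linarith
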